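/- Notation. For integers $n,q\ge 1$ and $a\in\mathbb Z$ put $$S_n(a,q)=\sum_{x \bmod q} e^{2\pi i a x^n/q},\qquad G_n(q)=\max_{\gcd(a,q)=1}|S_n(a,q)|.$$ For $k\ge 1$ let $\gamma_k$ be the $k$-th Hermite constant, i.e. the supremum, over all full-rank lattices $L\subset\mathbb R^k$, of $\min_{0\ne v\in L}\|v\|^2/\operatorname{covol}(L)^{2/k}$. For an integer $r\ge 2$ let $f_r$ be the least natural number with $\varphi(f_r)\ge r$, where $\varphi$ is Euler's function, and put $$C_r=\bigl(r\,\gamma_{r-1}^{r-1}\bigr)^{-1/r},\qquad K_r=4(1-1/f_r)\,C_r,\qquad \lambda=2\cdot 3^{-1/4}.$$ For an odd prime $p$, $[\![ b]\!]_p$ denotes the integer congruent to $b$ modulo $p$ with $-p/2<[\![ b]\!]_p<p/2$. Proposition. Let $n\ge 1$ be an integer, $p$ a prime, $g$ a generator of $\mathbb F_p^*$, and $\Theta\ge 1$ a real number; put $d=\gcd(n,p-1)$ and $t=(p-1)/d$. Let $r$ be an integer with $\varphi(t)\ge r\ge 2$ (so that $p$ is odd). Suppose that $$\sum_{x=1}^{t}[\![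 g^{dx+y}]\!]_p^2\ \ge\ \Theta F_r(t,p)\qquad(1\le y\le d),$$ where $$F_r(t,p)=\Bigl(\frac{p^{2(r-1)}\,t}{r\,\gamma_{r-1}^{r-1}}\Bigr)^{1/r}=C_r\,p^{2-2/r}\,t^{1/r},$$ and that $$p^{1-1/n}\ \ge\ 1+\lambda\Bigl(\frac{p^{5}\log p}{\Theta K_r (p-1)^{1/r}}\Bigr)^{3r/(16r-8)}.$$ Then $G_d(p)\le p^{1-1/n}$. -/

import Mathlib

namespace Stechkin

/-- The Gauss sum `S_n(a,q) = ∑_{x mod q} exp(2πi a xⁿ / q)`. -/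
noncomputable def S (n : ℕ) (a : ℤ) (q : ℕ) : ℂ :=
  ∑ x ∈ Finset.range q,
    Complex.exp (2 * (Real.pi : ℂ) * Complex.I * ((a : ℂ) * (x : ℂ) ^ n / (q : ℂ)))

/-- `G_n(q)`, the maximum of `|S_n(a,q)|` over all integers `a` coprime to `q`.
(Since `S_n(a,q)` depends only on `a` modulo `q`, the supremum is one of finitely many values.) -/
noncomputable def G (n q : ℕ) : ℝ :=
  sSup {s : ℝ | ∃ a : ℤ, Int.gcd a (q : ℤ) = 1 ∧ s = ‖S n a q‖}

/-- The minimal norm of a lattice `L`: the least squared length of a nonzero vector of `L`. -/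
noncomputable def minNorm {k : ℕ} (L : Submodule ℤ (EuclideanSpace ℝ (Fin k))) : ℝ :=
  sInf {s : ℝ | ∃ v ∈ L, v ≠ 0 ∧ s = ‖v‖ ^ 2}

/-- The `k`-th Hermite constant `γ_k` (for `k ≥ 1`): the supremum over all full-rank lattices
`L` in `ℝᵏ` of the minimal norm of `L` divided by `covol(L)^{2/k}`. -/
noncomputable def hermiteConstant (k : ℕ) : ℝ :=
  sSup {s : ℝ | ∃ (L : Submodule ℤ (EuclideanSpace ℝ (Fin k)))
    (_ : DiscreteTopology L) (_ : IsZLattice ℝ L),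
    s = minNorm L / (ZLattice.covolume L) ^ (2 / (k : ℝ))}

/-- `C_r = (r γ_{r-1}^{r-1})^{-1/r}`. -/
noncomputable def C (r : ℕ) : ℝ :=
  ((r : ℝ) * hermiteConstant (r - 1) ^ (r - 1)) ^ (-(1 / (r : ℝ)))

/-- `f_r` is the least natural number `f` with `φ(f) ≥ r`. -/
noncomputable def f (r : ℕ) : ℕ := sInf {m : ℕ | r ≤ Nat.totient m}

/-- `K_r = 4 (1 - 1/f_r) C_r`. -/
noncomputable def K (r : ℕ) : ℝ := 4 * (1 - 1 / (f r : ℝ)) * C r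

/-- `F_r(t,p) = (p^{2(r-1)} t / (r γ_{r-1}^{r-1}))^{1/r}`. -/
noncomputable def F (r t p : ℕ) : ℝ :=
  ((p : ℝ) ^ (2 * (r - 1)) * (t : ℝ) / ((r : ℝ) * hermiteConstant (r - 1) ^ (r - 1)))
    ^ (1 / (r : ℝ))

/-- `λ = 2 · 3^{-1/4}`. -/
noncomputable def lam : ℝ := 2 * (3 : ℝ) ^ (-(1 / 4) : ℝ)

end Stechkin

/-! Write `S d a p = 1 + d * T`, where `T` is the Gaussian period over the subgroup H of order t =
(p-1)/d. Two bounds for |T| compete, and one of them suffices for every d.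

Large d: |T|^2 is the sum over k in H of the real parts of the periods at a(k-1). The term k = 1 is
t; the others are at most t - 8M/p^2, where M = Θ F_r bounds the sums of squares from below, because
cos x ≤ 1 - 2x^2/π^2 on [-π, π]. Hence |T| ≤ t - 4(1 - 1/t)M/p^2 (`norm_period_le`). Since p - p log
p / n ≤ p^(1-1/n) and d ≤ n, this is enough once d^2 Y ≥ p^(1+2/r) log p · d^(1/r), with Y = Θ K_r
(p-1)^(1/r).

Small d: if that inequality fails, then λ(p^2 d)^(3/8) is at most the second term in the hypothesis
on p, so d|T| ≤ λ p^(3/4) d^(3/8) is enough (`norm_period_pow_eight_le_of_index`). Two uses of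
Cauchy-Schwarz give |T|^8 ≤ p E^2, with E the additive energy of H. It remains to show E ≤ (16/3)
t^(5/2) when 16 t^3 ≤ p^2 and t ≥ 24; outside this range |T| ≤ √p does the work.

The energy is controlled by the numbers J(w) of x with x^t = (x-1)^t = w. Stepanov's method
(`mul_sum_card_consecutive_le`) bounds the sum of J over any set W of values: an auxiliary
polynomial vanishes to order D at all these x, and is nonzero because a polynomial with few
monomials cannot vanish to high order at 1. Applying this to the level sets of J bounds the sum of
J^2. -/

namespace GaussPeriod

open Polynomial Finset

/-! ### Homogeneous systems with more unknowns than equations. -/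

section LinearSystem

variable {F : Type*} [Field F]

theorem exists_nontrivial_solution {α β : Type*} (I : Finset α) (J : Finset β)
    (h : #J < #I) (M : β → α → F) :
    ∃ c : α → F, (∃ i ∈ I, c i ≠ 0) ∧ ∀ j ∈ J, ∑ i ∈ I, c i * M j i = 0 := by
  classical
  let L : (I → F) →ₗ[F] (J → F) :=
    LinearMap.pi fun j => ∑ i : I, M j i • LinearMap.proj i
  have hL : LinearMap.ker L ≠ ⊥ := LinearMap.ker_ne_bot_of_finrank_lt (by simpa using h)
  obtain ⟨c, hc, hc0⟩ := (Submodule.ne_bot_iff _).mp hL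
  obtain ⟨i, hi⟩ := Function.ne_iff.mp hc0
  refine ⟨fun a => if ha : a ∈ I then c ⟨a, ha⟩ else 0, ⟨i, i.2, by simpa using hi⟩, ?_⟩
  intro j hj
  have := congrFun (LinearMap.mem_ker.mp hc) ⟨j, hj⟩
  simp only [L, LinearMap.pi_apply, LinearMap.sum_apply, LinearMap.smul_apply,
    LinearMap.proj_apply, smul_eq_mul, Pi.zero_apply] at this
  rw [← this, ← Finset.sum_coe_sort I]
  exact Finset.sum_congr rfl fun x _ => by simp [mul_comm]

end LinearSystem

/-! ### Sparse polynomials vanish to low order at 1. -/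

section Sparse

variable {F : Type*} [Field F] {P : ℕ}

/-- In characteristic at least `P`, a nonzero polynomial of degree less than `P` that vanishes
to order `m` at `1` has more than `m` monomials. -/
theorem lt_card_support_of_pow_dvd (hP : ∀ m : ℕ, 0 < m → m < P → (m : F) ≠ 0) (m : ℕ) :
    ∀ f : F[X], f ≠ 0 → f.natDegree < P → (X - 1 : F[X]) ^ m ∣ f → m < #f.support := by
  induction m with
  | zero =>
    intro f hf _ _
    exact Finset.card_pos.mpr (nonempty_support_iff.mpr hf)
  | succ m ih =>
    intro f hf hdeg hdvd
    set k := f.natDegree with hk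
    -- This operator kills the leading monomial, creates no new ones, and lowers the order of
    -- vanishing at 1 by at most one. If the result is zero, the degree bound makes `f` a single
    -- monomial, which does not vanish at 1.
    set g : F[X] := X * derivative f - C (k : F) * f with hg
    have hcoef : ∀ n, g.coeff n = ((n : F) - k) * f.coeff n := by
      intro n
      rw [hg, coeff_sub, coeff_C_mul]
      cases n with
      | zero => simp
      | succ n => rw [coeff_X_mul, coeff_derivative]; push_cast; ring
    have hgdvd : (X - 1 : F[X]) ^ m ∣ g := by
      refine dvd_sub (dvd_mul_of_dvd_right ?_ _) (dvd_mul_of_dvd_right ?_ _)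
      · obtain ⟨q, rfl⟩ := hdvd
        rw [derivative_mul, derivative_pow]
        refine dvd_add ?_ ?_
        · refine Dvd.dvd.mul_right (Dvd.dvd.mul_right ?_ _) _
          simp
        · exact Dvd.dvd.mul_right (pow_dvd_pow _ (Nat.le_succ m)) _
      · exact (pow_dvd_pow _ (Nat.le_succ m)).trans hdvd
    have hsub : g.support ⊆ f.support.erase k := by
      intro n hn
      rw [mem_support_iff, hcoef] at hn
      rw [Finset.mem_erase, mem_support_iff]
      refine ⟨fun h => hn (by simp [h]), fun h => hn (by simp [h])⟩
    have hkmem : k ∈ f.support := natDegree_mem_support_of_nonzero hf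
    by_cases hg0 : g = 0
    · exfalso
      have hmono : f = monomial k (f.coeff k) := by
        ext n
        rw [coeff_monomial]
        split_ifs with h
        · rw [h]
        · by_contra hne
          have h1 := hcoef n
          rw [hg0, coeff_zero] at h1
          have hnk : n < k := lt_of_le_of_ne (le_natDegree_of_ne_zero hne) (Ne.symm h)
          have h2 := hP (k - n) (by omega) (by omega)
          rw [Nat.cast_sub hnk.le] at h2
          rcases mul_eq_zero.mp h1.symm with h3 | h3
          · exact h2 (by rw [← neg_sub, h3, neg_zero])
          · exact hne h3
      have heval : f.eval 1 = 0 := by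
        obtain ⟨q, hq⟩ := hdvd
        rw [hq]
        simp
      rw [hmono, eval_monomial, one_pow, mul_one] at heval
      exact (mem_support_iff.mp hkmem) heval
    · have hgdeg : g.natDegree ≤ f.natDegree := le_natDegree_of_mem_supp _
        (Finset.mem_of_mem_erase (hsub (natDegree_mem_support_of_nonzero hg0)))
      have h1 := ih g hg0 (hgdeg.trans_lt hdeg) hgdvd
      have h2 := Finset.card_le_card hsub
      rw [Finset.card_erase_of_mem hkmem] at h2
      have := Finset.card_pos.mpr ⟨k, hkmem⟩
      omega

end Sparse

/-! ### Derivatives of the building blocks of the auxiliary polynomial. -/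

section Auxiliary

variable {F : Type*} [Field F]

/-- The polynomials `P_n` with
`(X(X-1))^n (d/dX)^n (X^a X^(tb) (X-1)^(tc)) = P_n X^(tb) (X-1)^(tc)`. -/
noncomputable def stepPoly (F : Type*) [Field F] (a k l : ℕ) : ℕ → F[X]
  | 0 => X ^ a
  | n + 1 => X * (X - 1) * derivative (stepPoly F a k l n) +
      ((k : F[X]) * (X - 1) + (l : F[X]) * X - (n : F[X]) * (2 * X - 1)) * stepPoly F a k l n

theorem natDegree_stepPoly (a k l n : ℕ) : (stepPoly F a k l n).natDegree ≤ a + n := by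
  induction n with
  | zero => simp [stepPoly]
  | succ n ih =>
    rw [stepPoly]
    have h1 : (X * (X - 1) : F[X]).natDegree ≤ 2 := by compute_degree
    have h2 : ((k : F[X]) * (X - 1) + (l : F[X]) * X - (n : F[X]) * (2 * X - 1)).natDegree ≤ 1 := by
      compute_degree
    refine natDegree_add_le_of_degree_le ?_ ?_
    · by_cases h : derivative (stepPoly F a k l n) = 0
      · simp [h]
      · have h0 : (stepPoly F a k l n).natDegree ≠ 0 := by
          intro h0
          rw [natDegree_eq_zero] at h0
          obtain ⟨c, hc⟩ := h0
          exact h (by rw [← hc, derivative_C])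
        have h3 := natDegree_derivative_lt h0
        have h4 := natDegree_mul_le (p := (X * (X - 1) : F[X]))
          (q := derivative (stepPoly F a k l n))
        omega
    · have h4 := natDegree_mul_le
        (p := ((k : F[X]) * (X - 1) + (l : F[X]) * X - (n : F[X]) * (2 * X - 1)))
        (q := stepPoly F a k l n)
      omega

theorem stepPoly_spec (a k l n : ℕ) :
    (X * (X - 1)) ^ n * derivative^[n] (X ^ a * (X ^ k * (X - 1) ^ l) : F[X]) =
      stepPoly F a k l n * (X ^ k * (X - 1) ^ l) := by
  induction n with
  | zero => simp [stepPoly]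
  | succ n ih =>
    -- Logarithmic derivative of the monomial; the case split disposes of the truncated exponents k
    -- - 1 and l - 1.
    have hM : X * (X - 1) * derivative (X ^ k * (X - 1) ^ l : F[X]) =
        ((k : F[X]) * (X - 1) + (l : F[X]) * X) * (X ^ k * (X - 1) ^ l) := by
      rw [derivative_mul, derivative_pow, derivative_pow]
      simp only [derivative_X, derivative_sub, derivative_one, sub_zero, mul_one]
      rcases k with _ | k <;> rcases l with _ | l <;>
        simp only [Nat.cast_zero, map_zero, zero_mul, map_natCast, Nat.add_sub_cancel] <;> ring
    have hd := congrArg derivative ih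
    rw [derivative_mul, derivative_mul (f := stepPoly F a k l n), derivative_pow,
      ← Function.iterate_succ_apply' derivative] at hd
    set G := derivative^[n + 1] (X ^ a * (X ^ k * (X - 1) ^ l) : F[X]) with hG
    set G0 := derivative^[n] (X ^ a * (X ^ k * (X - 1) ^ l) : F[X]) with hG0
    set M := (X ^ k * (X - 1) ^ l : F[X]) with hMdef
    set Q := stepPoly F a k l n with hQ
    have hx : derivative (X * (X - 1) : F[X]) = 2 * X - 1 := by
      rw [derivative_mul]; simp; ring
    rw [hx] at hd
    have hn : X * (X - 1) * (C (n : F) * (X * (X - 1)) ^ (n - 1) * (2 * X - 1) * G0)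
        = (n : F[X]) * (2 * X - 1) * (Q * M) := by
      rw [← ih]
      rcases n with _ | n
      · simp
      · simp only [Nat.add_sub_cancel, map_natCast]; ring
    rw [stepPoly, ← hQ]
    have h2 := congrArg (fun z => X * (X - 1) * z) hd
    simp only [mul_add] at h2
    rw [hn] at h2
    linear_combination h2 + Q * hM

end Auxiliary

end GaussPeriod

namespace GaussPeriod

open Polynomial Finset

/-! ### Stepanov's method for several values of w at once. -/

section Stepanov

variable {F : Type*} [Field F] {P : ℕ}

theorem two_mul_sum_range_sub (B : ℕ) : 2 * ∑ c ∈ range B, (B - c) = B * (B + 1) := by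
  induction B with
  | zero => simp
  | succ B ih =>
    rw [Finset.sum_range_succ']
    simp only [Nat.add_sub_add_right, Nat.sub_zero]
    rw [mul_add, ih]; ring

theorem two_mul_sum_range_add (A D : ℕ) :
    2 * ∑ n ∈ range D, (A + n) = 2 * (A * D) + D * (D - 1) := by
  rw [Finset.sum_add_distrib, mul_add, mul_comm 2 (∑ n ∈ range D, n), Finset.sum_range_id_mul_two]
  simp [mul_comm]

/-- The polynomial `∑ c_{abc} X^a X^(tb) (X-1)^(tc)` over `a < A`, `b + c < B`. -/
noncomputable def stepanovPoly (t A B : ℕ) (u : ℕ × (Σ _ : ℕ, ℕ) → F) : F[X] :=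
  ∑ i ∈ range A ×ˢ (range B).sigma (fun c => range (B - c)),
    C (u i) * (X ^ i.1 * (X ^ (t * i.2.2) * (X - 1) ^ (t * i.2.1)))

theorem natDegree_stepanovPoly (t A B : ℕ) (u : ℕ × (Σ _ : ℕ, ℕ) → F) :
    (stepanovPoly t A B u).natDegree ≤ A - 1 + t * (B - 1) := by
  refine natDegree_sum_le_of_forall_le _ _ fun i hi => ?_
  obtain ⟨a, c, b⟩ := i
  simp only [mem_product, mem_range, mem_sigma] at hi
  obtain ⟨ha, hc, hb⟩ := hi
  have h1 : (C (u (a, ⟨c, b⟩)) * (X ^ a * (X ^ (t * b) * (X - 1) ^ (t * c))) : F[X]).natDegree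
      ≤ 0 + (a + (t * b + t * c * 1)) := by
    refine natDegree_mul_le_of_le (natDegree_C _).le (natDegree_mul_le_of_le
      (natDegree_X_pow_le _) (natDegree_mul_le_of_le (natDegree_X_pow_le _)
      (natDegree_pow_le_of_le _ (by compute_degree))))
  refine h1.trans ?_
  have : t * b + t * c ≤ t * (B - 1) := by
    rw [← mul_add]; exact Nat.mul_le_mul_left _ (by omega)
  omega

/-- Group the terms by the power (X-1)^(tc). The exponents a + tb inside one group are distinct
since A ≤ t, so some group is nonzero. If the total vanished, the first nonzero group would be
divisible by (X-1)^t while having at most AB ≤ t monomials. -/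
theorem stepanovPoly_ne_zero (hP : ∀ m : ℕ, 0 < m → m < P → (m : F) ≠ 0) {t A B : ℕ}
    (hAB : A * B ≤ t) (hdeg : A - 1 + t * (B - 1) < P) (u : ℕ × (Σ _ : ℕ, ℕ) → F)
    (hu : ∃ i ∈ range A ×ˢ (range B).sigma (fun c => range (B - c)), u i ≠ 0) :
    stepanovPoly t A B u ≠ 0 := by
  classical
  intro hzero
  set G : ℕ → F[X] := fun c => ∑ q ∈ range A ×ˢ range (B - c),
    C (u (q.1, ⟨c, q.2⟩)) * X ^ (q.1 + t * q.2) with hG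
  have hsum : ∑ c ∈ range B, G c * (X - 1) ^ (t * c) = 0 := by
    rw [← hzero, stepanovPoly, Finset.sum_product_right, Finset.sum_sigma]
    refine Finset.sum_congr rfl fun c _ => ?_
    rw [hG, Finset.sum_mul, Finset.sum_product_right]
    refine Finset.sum_congr rfl fun b _ => Finset.sum_congr rfl fun a _ => ?_
    simp only [pow_add]; ring
  have hcoef : ∀ a < A, ∀ c, ∀ b < B - c, (G c).coeff (a + t * b) = u (a, ⟨c, b⟩) := by
    intro a ha c b hb
    have hAt : A ≤ t := le_trans (Nat.le_mul_of_pos_right A (by omega)) hAB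
    rw [hG, finsetSum_coeff, Finset.sum_eq_single (a, b)]
    · simp
    · rintro ⟨a', b'⟩ hq hne
      simp only [mem_product, mem_range] at hq
      rw [coeff_C_mul, coeff_X_pow, if_neg, mul_zero]
      intro h
      apply hne
      have h1 : a = a' := by
        have := congrArg (· % t) h
        simpa [Nat.mod_eq_of_lt (lt_of_lt_of_le ha hAt),
          Nat.mod_eq_of_lt (lt_of_lt_of_le hq.1 hAt)] using this
      have h2 : t * b = t * b' := by dsimp only at h; omega
      have h3 := Nat.eq_of_mul_eq_mul_left (by omega) h2
      simp only [h1, h3]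
    · intro h
      exact absurd (by simp [ha, hb]) h
  have hex : ∃ c, c < B ∧ G c ≠ 0 := by
    obtain ⟨⟨a, c, b⟩, hi, hne⟩ := hu
    simp only [mem_product, mem_range, mem_sigma] at hi
    refine ⟨c, hi.2.1, fun h => hne ?_⟩
    rw [← hcoef a hi.1 c b hi.2.2, h, coeff_zero]
  obtain ⟨hc0, hGc0⟩ := Nat.find_spec hex
  set c₀ := Nat.find hex
  have hlow : ∀ c < c₀, G c = 0 := by
    intro c hc
    by_contra h
    exact Nat.find_min hex hc ⟨hc.trans hc0, h⟩
  have hdvd : (X - 1 : F[X]) ^ t ∣ G c₀ := by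
    have hX : (X - 1 : F[X]) ≠ 0 := X_sub_C_ne_zero 1
    have h1 : (X - 1 : F[X]) ^ (t * c₀) * (X - 1) ^ t ∣ (X - 1) ^ (t * c₀) * G c₀ := by
      rw [← Finset.add_sum_erase _ _ (mem_range.mpr hc0)] at hsum
      have h2 : (X - 1) ^ (t * c₀) * G c₀
          = -∑ c ∈ (range B).erase c₀, G c * (X - 1) ^ (t * c) := by
        rw [mul_comm]; exact eq_neg_of_add_eq_zero_left hsum
      rw [h2, dvd_neg]
      refine Finset.dvd_sum fun c hc => ?_
      rcases lt_or_gt_of_ne (Finset.ne_of_mem_erase hc) with h | h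
      · simp [hlow c h]
      · refine dvd_mul_of_dvd_right ?_ _
        rw [← pow_add]
        refine pow_dvd_pow _ ?_
        calc t * c₀ + t = t * (c₀ + 1) := by ring
          _ ≤ t * c := Nat.mul_le_mul_left _ h
    exact (mul_dvd_mul_iff_left (pow_ne_zero _ hX)).mp h1
  have hdegG : (G c₀).natDegree ≤ A - 1 + t * (B - 1) := by
    refine natDegree_sum_le_of_forall_le _ _ fun q hq => ?_
    simp only [mem_product, mem_range] at hq
    refine (natDegree_C_mul_X_pow_le _ _).trans ?_
    have : t * q.2 ≤ t * (B - 1) := Nat.mul_le_mul_left _ (by omega)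
    omega
  have hsupp : #(G c₀).support ≤ A * B := by
    have h1 : (G c₀).support ⊆ (range A ×ˢ range (B - c₀)).image (fun q => q.1 + t * q.2) := by
      intro n hn
      by_contra hnot
      refine (mem_support_iff.mp hn) ?_
      rw [hG, finsetSum_coeff]
      refine Finset.sum_eq_zero fun q hq => ?_
      rw [coeff_C_mul, coeff_X_pow, if_neg, mul_zero]
      rintro rfl
      exact hnot (Finset.mem_image_of_mem _ hq)
    calc #(G c₀).support ≤ _ := Finset.card_le_card h1
      _ ≤ _ := Finset.card_image_le
      _ = A * (B - c₀) := by simp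
      _ ≤ A * B := Nat.mul_le_mul_left _ (Nat.sub_le _ _)
  have := lt_card_support_of_pow_dvd hP t (G c₀) hGc0 (hdegG.trans_lt hdeg) hdvd
  omega

/-- The solutions of `x^t = (x-1)^t = w`. -/
def consecutive (t : ℕ) [Fintype F] [DecidableEq F] (w : F) : Finset F :=
  univ.filter fun x => x ^ t = w ∧ (x - 1) ^ t = w

/-- Stepanov's method: a bound for the number of `x` such that `x^t = (x-1)^t` belongs to `W`. -/
theorem mul_sum_card_consecutive_le [Fintype F] [DecidableEq F]
    (hP : ∀ m : ℕ, 0 < m → m < P → (m : F) ≠ 0) {t A B D : ℕ} (W : Finset F)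
    (hW : ∀ w ∈ W, w ≠ 0) (ht : 1 ≤ t) (hAB : A * B ≤ t) (hdeg : A - 1 + t * (B - 1) < P)
    (hD : D ≤ P)
    (hcount : #W * (2 * (A * D) + D * (D - 1)) < A * (B * (B + 1))) :
    D * ∑ w ∈ W, #(consecutive t w) ≤ A - 1 + t * (B - 1) := by
  classical
  rcases Nat.eq_zero_or_pos D with rfl | hDpos
  · simp
  -- `I` indexes the unknown coefficients; `J` indexes the conditions: a value w, an order n < D of
  -- derivative, and a coefficient of a polynomial of degree less than A + n.
  set I := range A ×ˢ (range B).sigma (fun c => range (B - c)) with hI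
  set J := W ×ˢ (range D).sigma (fun n => range (A + n)) with hJ
  have hcard : #J < #I := by
    have h1 : 2 * #I = A * (B * (B + 1)) := by
      simp only [hI, card_product, card_range, card_sigma]
      rw [← two_mul_sum_range_sub]; ring
    have h2 : 2 * #J = #W * (2 * (A * D) + D * (D - 1)) := by
      simp only [hJ, card_product, card_range, card_sigma]
      rw [← two_mul_sum_range_add]; ring
    omega
  -- At a point of `consecutive t w` the factor X^(tb)(X-1)^(tc) equals w^(b+c), so the n-th
  -- derivative becomes, up to a nonzero factor, a polynomial in x depending on w alone. All its
  -- coefficients are made zero.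
  obtain ⟨u, hu, hsol⟩ := exists_nontrivial_solution I J hcard
    (fun j i => j.1 ^ (i.2.2 + i.2.1) *
      (stepPoly F i.1 (t * i.2.2) (t * i.2.1) j.2.1).coeff j.2.2)
  set Ψ := stepanovPoly t A B u with hΨ
  have hne : Ψ ≠ 0 := stepanovPoly_ne_zero hP hAB hdeg u hu
  have hmult : ∀ w ∈ W, ∀ x ∈ consecutive t w, D ≤ Ψ.rootMultiplicity x := by
    intro w hw x hx
    simp only [consecutive, mem_filter, mem_univ, true_and] at hx
    have hx0 : x ≠ 0 := by
      rintro rfl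
      exact hW w hw (by rw [← hx.1, zero_pow (by omega)])
    have hx1 : x - 1 ≠ 0 := by
      intro h
      exact hW w hw (by rw [← hx.2, h, zero_pow (by omega)])
    have hkey : ∀ n < D, (derivative^[n] Ψ).IsRoot x := by
      intro n hn
      have h1 : ((X * (X - 1)) ^ n * derivative^[n] Ψ).eval x = 0 := by
        rw [hΨ, stepanovPoly, iterate_derivative_sum, Finset.mul_sum, eval_finsetSum]
        calc _ = ∑ i ∈ I, ∑ j ∈ range (A + n), x ^ j * (u i * (w ^ (i.2.2 + i.2.1) *
              (stepPoly F i.1 (t * i.2.2) (t * i.2.1) n).coeff j)) := by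
              refine Finset.sum_congr rfl fun i hi => ?_
              rw [iterate_derivative_C_mul, mul_left_comm, stepPoly_spec, eval_mul, eval_C,
                eval_mul, eval_mul, eval_pow, eval_pow, eval_sub, eval_X, eval_one, pow_mul,
                pow_mul, hx.1, hx.2, ← pow_add]
              have hlt : (stepPoly F i.1 (t * i.2.2) (t * i.2.1) n).natDegree < A + n := by
                have := natDegree_stepPoly (F := F) i.1 (t * i.2.2) (t * i.2.1) n
                simp only [hI, mem_product, mem_range] at hi
                omega
              rw [eval_eq_sum_range' hlt, Finset.sum_mul, Finset.mul_sum]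
              exact Finset.sum_congr rfl fun j _ => by ring
          _ = 0 := by
              rw [Finset.sum_comm]
              refine Finset.sum_eq_zero fun j hj => ?_
              rw [← Finset.mul_sum, hsol (w, ⟨n, j⟩) (by
                simp only [hJ, mem_product, mem_sigma, mem_range]
                exact ⟨hw, hn, mem_range.mp hj⟩), mul_zero]
      rw [eval_mul, eval_pow, eval_mul, eval_sub, eval_X, eval_one] at h1
      exact (mul_eq_zero.mp h1).resolve_left (pow_ne_zero _ (mul_ne_zero hx0 hx1))
    -- D ≤ P keeps the integers 1, ..., D - 1 nonzero in the field, so vanishing derivatives do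
    -- force multiplicity D.
    have := lt_rootMultiplicity_of_isRoot_iterate_derivative_of_mem_nonZeroDivisors' (n := D - 1)
      hne (fun m hm => hkey m (by omega))
      (fun m hm hm0 => mem_nonZeroDivisors_of_ne_zero (hP m (by omega) (by omega)))
    omega
  set U := W.biUnion (consecutive t) with hU
  have hUcard : #U = ∑ w ∈ W, #(consecutive t w) := by
    refine Finset.card_biUnion fun w _ w' _ hww => ?_
    rw [Function.onFun, Finset.disjoint_left]
    intro x hx hx'
    simp only [consecutive, mem_filter] at hx hx'
    exact hww (hx.2.1.symm.trans hx'.2.1)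
  have hUm : ∀ x ∈ U, D ≤ Ψ.roots.count x := by
    intro x hx
    rw [hU, mem_biUnion] at hx
    obtain ⟨w, hw, hx⟩ := hx
    rw [count_roots]
    exact hmult w hw x hx
  calc D * ∑ w ∈ W, #(consecutive t w) = ∑ _x ∈ U, D := by
        rw [← hUcard, Finset.sum_const, smul_eq_mul, mul_comm]
    _ ≤ ∑ x ∈ U, Ψ.roots.count x := Finset.sum_le_sum hUm
    _ ≤ ∑ x ∈ Ψ.roots.toFinset, Ψ.roots.count x := by
        refine Finset.sum_le_sum_of_subset fun x hx => ?_
        rw [Multiset.mem_toFinset, ← Multiset.count_pos]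
        exact hDpos.trans_le (hUm x hx)
    _ = Multiset.card Ψ.roots := Multiset.toFinset_sum_count_eq _
    _ ≤ Ψ.natDegree := card_roots' _
    _ ≤ _ := natDegree_stepanovPoly t A B u

end Stepanov

end GaussPeriod

namespace GaussPeriod

open Polynomial Finset

/-! ### Elementary inequalities for summing over level sets. -/

section RealBounds

/-- Telescoping: 1/h^2 ≤ 1/(h - 1/2) - 1/(h + 1/2). -/
theorem sum_inv_sq_le (m n : ℕ) (hm : 1 ≤ m) :
    ∑ h ∈ Ico m n, (1 : ℝ) / (h : ℝ) ^ 2 ≤ 2 / (2 * m - 1) := by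
  have hm' : (1 : ℝ) ≤ m := by exact_mod_cast hm
  rcases le_total n m with hn | hn
  · rw [Finset.Ico_eq_empty (by omega), Finset.sum_empty]
    exact div_nonneg (by norm_num) (by linarith)
  · have key : ∑ h ∈ Ico m n, (1 : ℝ) / (h : ℝ) ^ 2 ≤ 2 / (2 * m - 1) - 2 / (2 * n - 1) := by
      induction n, hn using Nat.le_induction with
      | base => simp
      | succ n hn ih =>
        rw [Finset.sum_Ico_succ_top hn]
        have hn' : (1 : ℝ) ≤ n := hm'.trans (by exact_mod_cast hn)
        have h1 : (1 : ℝ) / (n : ℝ) ^ 2 ≤ 2 / (2 * n - 1) - 2 / (2 * (n + 1) - 1) := by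
          have ha : (0 : ℝ) < 2 * n - 1 := by linarith
          have hb : (0 : ℝ) < 2 * (n + 1) - 1 := by linarith
          rw [div_sub_div _ _ ha.ne' hb.ne', div_le_div_iff₀ (by positivity) (by positivity)]
          nlinarith
        push_cast
        linarith
    have : (0 : ℝ) ≤ 2 / (2 * n - 1) := by
      have : (m : ℝ) ≤ n := by exact_mod_cast hn
      exact div_nonneg (by norm_num) (by linarith)
    linarith

/-- Layer-cake formula; truncated subtraction lets all j share the same range of summation. -/
theorem sq_add_self_eq_two_mul_sum (j t : ℕ) (h : j ≤ t) :
    j ^ 2 + j = 2 * ∑ i ∈ range t, (j - i) := by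
  have h1 : ∑ i ∈ range t, (j - i) = ∑ i ∈ range j, (j - i) := by
    symm
    refine Finset.sum_subset (by simpa using h) fun i _ hi => ?_
    rw [mem_range] at hi
    omega
  rw [h1, two_mul_sum_range_sub]; ring

/-- Optimising a linear functional of the number of cosets. -/
theorem cubic_bound {x h T : ℝ} (hx : 0 < x) (hh : 0 < h) :
    9 / 16 * (T ^ 2 / x ^ 2) - h * (T ^ 2 / (8 * x ^ 3)) ≤ 27 / 16 * (T ^ 2 / h ^ 2) := by
  -- The left side of the goal is maximal at h = 3x, whence the double root.
  have h1 : 27 / 16 * (T ^ 2 / h ^ 2) - (9 / 16 * (T ^ 2 / x ^ 2) - h * (T ^ 2 / (8 * x ^ 3))) =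
      T ^ 2 * ((h - 3 * x) ^ 2 * (2 * h + 3 * x)) / (16 * h ^ 2 * x ^ 3) := by
    field_simp
    ring
  have h2 : 0 ≤ T ^ 2 * ((h - 3 * x) ^ 2 * (2 * h + 3 * x)) / (16 * h ^ 2 * x ^ 3) := by
    positivity
  linarith

end RealBounds

/-! ### Choice of parameters in Stepanov's method. -/

section Energy

variable {F : Type*} [Field F] [Fintype F] [DecidableEq F] {P : ℕ}

/-- The choice D = 2A: each w then costs A(8A - 2) in the count, and the slack 2 · #W absorbs the +
1 in `hcount`. -/
theorem mul_sum_card_consecutive_le' (hP : ∀ m : ℕ, 0 < m → m < P → (m : F) ≠ 0) {t A B : ℕ}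
    (W : Finset F) (hW : ∀ w ∈ W, w ≠ 0) (hN : 1 ≤ #W) (ht : 1 ≤ t) (hA : 1 ≤ A)
    (hAB : A * B ≤ t) (hdeg : A - 1 + t * (B - 1) < P) (hD : 2 * A ≤ P)
    (hcount : 8 * #W * A ≤ B * (B + 1) + 1) :
    2 * A * ∑ w ∈ W, #(consecutive t w) ≤ A - 1 + t * (B - 1) := by
  refine mul_sum_card_consecutive_le hP W hW ht hAB hdeg hD ?_
  have h1 : 2 * (A * (2 * A)) + 2 * A * (2 * A - 1) = A * (8 * A - 2) := by
    obtain ⟨a, rfl⟩ := Nat.exists_eq_add_of_le hA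
    have e1 : 2 * (1 + a) - 1 = 1 + 2 * a := by omega
    have e2 : 8 * (1 + a) - 2 = 6 + 8 * a := by omega
    rw [e1, e2]; ring
  rw [h1, mul_left_comm]
  refine Nat.mul_lt_mul_of_pos_left ?_ hA
  have h2 : #W * (8 * A - 2) + 2 * #W = 8 * #W * A := by
    obtain ⟨a, rfl⟩ := Nat.exists_eq_add_of_le hA
    have e2 : 8 * (1 + a) - 2 = 6 + 8 * a := by omega
    rw [e2]; ring
  omega

/-- Every point counted is a root of X^t - (X-1)^t, whose coefficient at X^(t-1) is t. -/
theorem sum_card_consecutive_le {t : ℕ} (ht : 1 ≤ t) (htF : (t : F) ≠ 0) :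
    ∑ w ∈ univ.erase (0 : F), #(consecutive t w) ≤ t - 1 := by
  classical
  set f : F[X] := X ^ t - (X - C 1) ^ t with hf
  have hcoef : f.coeff (t - 1) ≠ 0 := by
    rw [hf, coeff_sub, coeff_X_pow, if_neg (by omega), sub_eq_add_neg X, ← C_neg,
      coeff_X_add_C_pow]
    have e : t - (t - 1) = 1 := by omega
    rw [e, Nat.choose_symm_of_eq_add (show t = (t - 1) + 1 by omega)]
    simpa using htF
  have hf0 : f ≠ 0 := by
    intro h; rw [h] at hcoef; exact hcoef (coeff_zero _)
  have hdeg : f.natDegree ≤ t - 1 := by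
    have : f.degree < (X ^ t : F[X]).degree := by
      refine degree_sub_lt_left ?_ (pow_ne_zero _ X_ne_zero) ?_
      · rw [degree_X_pow, degree_pow, degree_X_sub_C]; simp
      · rw [leadingCoeff_X_pow, leadingCoeff_pow, leadingCoeff_X_sub_C, one_pow]
    rw [degree_X_pow] at this
    have := (natDegree_lt_iff_degree_lt hf0).mpr this
    omega
  have hcard : ∑ w ∈ univ.erase (0 : F), #(consecutive t w) ≤ #f.roots.toFinset := by
    rw [← Finset.card_biUnion]
    · refine Finset.card_le_card fun x hx => ?_
      simp only [mem_biUnion, consecutive, mem_filter] at hx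
      obtain ⟨w, _, _, h1, h2⟩ := hx
      rw [Multiset.mem_toFinset, mem_roots hf0, IsRoot.def, hf]
      simp [h1, h2]
    · intro w _ w' _ hww
      rw [Function.onFun, Finset.disjoint_left]
      intro x hx hx'
      simp only [consecutive, mem_filter] at hx hx'
      exact hww (hx.2.1.symm.trans hx'.2.1)
  calc _ ≤ #f.roots.toFinset := hcard
    _ ≤ Multiset.card f.roots := Multiset.toFinset_card_le _
    _ ≤ f.natDegree := card_roots' _
    _ ≤ t - 1 := hdeg

set_option maxHeartbeats 1000000 in
/-- The main consequence of Stepanov's method for several cosets. -/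
theorem sum_card_consecutive_le_of_cube (hP : ∀ m : ℕ, 0 < m → m < P → (m : F) ≠ 0) {t : ℕ}
    (ht : 180 ≤ t) (htP : 16 * t ^ 3 ≤ P ^ 2) (W : Finset F) (hW : ∀ w ∈ W, w ≠ 0)
    (hN : 1 ≤ #W) (hNt : 169 * #W ^ 2 ≤ 100 * t) {x : ℝ} (hx : 0 < x)
    (hx3 : 8 * (#W : ℝ) * x ^ 3 = (t : ℝ) ^ 2) :
    ((∑ w ∈ W, #(consecutive t w) : ℕ) : ℝ) ≤ 9 / 16 * ((t : ℝ) ^ 2 / x ^ 2) := by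
  set N := #W with hNdef
  set T : ℝ := (t : ℝ) with hT
  have hT180 : (180 : ℝ) ≤ T := by rw [hT]; exact_mod_cast ht
  have hN1 : (1 : ℝ) ≤ N := by exact_mod_cast hN
  have hNT : 169 * (N : ℝ) ^ 2 ≤ 100 * T := by rw [hT]; exact_mod_cast hNt
  set s := Real.sqrt T with hs
  have hs2 : s ^ 2 = T := Real.sq_sqrt (by linarith)
  have hs0 : 0 ≤ s := Real.sqrt_nonneg _
  have hs13 : (13.416 : ℝ) ≤ s := Real.le_sqrt_of_sq_le (by norm_num; linarith)
  have hNs : 13 * (N : ℝ) ≤ 10 * s := by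
    refine le_of_sq_le_sq ?_ (by positivity)
    nlinarith
  have hTpos : 0 < T := by linarith
  -- From N ≤ (10/13)√T, x^3 ≥ (13/80) T^(3/2), and 0.545^3 < 13/80.
  have hxs : 0.545 * s ≤ x := by
    by_contra! hlt
    have h1 : x ^ 3 < (0.545 * s) ^ 3 := pow_lt_pow_left₀ hlt hx.le (by norm_num)
    have h2 : 8 * (N : ℝ) * x ^ 3 < 8 * (10 / 13 * s) * (0.545 * s) ^ 3 := by
      have h3 : 8 * (N : ℝ) ≤ 8 * (10 / 13 * s) := by linarith
      have h4 : 0 < x ^ 3 := by positivity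
      calc 8 * (N : ℝ) * x ^ 3 ≤ 8 * (10 / 13 * s) * x ^ 3 := by gcongr
        _ < _ := by gcongr
    rw [hx3, ← hs2] at h2
    have h5 : 0 < s ^ 4 := by positivity
    nlinarith
  -- From N ≥ 1, x ≤ T^(2/3)/2, and T ≥ 180.
  have hxT : x ≤ 0.0886 * T := by
    by_contra! hlt
    have h1 : (0.0886 * T) ^ 3 < x ^ 3 := pow_lt_pow_left₀ hlt (by positivity) (by norm_num)
    have h2 : 8 * x ^ 3 ≤ T ^ 2 := by
      rw [← hx3]; have : 0 < x ^ 3 := by positivity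
      nlinarith
    have h3 : 0 < T ^ 2 := by positivity
    nlinarith
  have hx731 : (7.31 : ℝ) ≤ x := by nlinarith
  -- Ideally A = x and B = T/x: then AB = T, B^2 = 8NA, and the bound is near T^2/(2x^2). Shrinking
  -- x to xT/(x + T) leaves room for rounding B up, since A(T/x + 1) ≤ T.
  set q : ℝ := x * T / (x + T) with hq
  have hqx : q * (x + T) = x * T := by rw [hq]; field_simp
  set A := ⌊q⌋₊ with hA
  have hq0 : 0 ≤ q := by positivity
  have hAq : (A : ℝ) ≤ q := Nat.floor_le hq0
  have hAq' : q < A + 1 := Nat.lt_floor_add_one q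
  have hA0 : (0 : ℝ) ≤ A := Nat.cast_nonneg _
  have hqx' : q ≤ x := by
    rw [hq, div_le_iff₀ (by positivity)]; nlinarith
  have hAx : (A : ℝ) ≤ x := hAq.trans hqx'
  have hAlow : 0.804 * x ≤ A := by
    have h1 : x - x ^ 2 / T ≤ q := by
      rw [hq, le_div_iff₀ (by positivity)]
      have : (x - x ^ 2 / T) * (x + T) = x * T - x ^ 3 / T := by field_simp; ring
      rw [this]
      have : 0 ≤ x ^ 3 / T := by positivity
      linarith
    -- Total loss from shrinking x and taking the floor; T ≥ 180 serves for x ≤ 10, and x ≤ 0.0886 T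
    -- beyond.
    have h2 : x ^ 2 / T + 1 ≤ 0.196 * x := by
      rcases le_total x 10 with hc | hc
      · have : x ^ 2 / T ≤ x * (1 / 18) := by
          rw [div_le_iff₀ hTpos]; nlinarith
        linarith
      · have : x ^ 2 / T ≤ x * 0.0886 := by
          rw [div_le_iff₀ hTpos]; nlinarith
        linarith
    linarith
  have hA1 : 1 ≤ A := by
    have : (1 : ℝ) ≤ A := by linarith
    exact_mod_cast this
  have hex : ∃ B : ℕ, 8 * N * A ≤ B * (B + 1) :=
    ⟨8 * N * A, Nat.le_mul_of_pos_right _ (Nat.succ_pos _)⟩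
  set B := Nat.find hex with hB
  have hBspec : 8 * N * A ≤ B * (B + 1) := Nat.find_spec hex
  have hB1 : 1 ≤ B := by
    by_contra h
    have h0 : B = 0 := by omega
    rw [h0] at hBspec
    have : 0 < 8 * N * A := by positivity
    omega
  have hBmin : (B - 1) * (B - 1) ≤ 8 * N * A := by
    have h1 := Nat.find_min hex (m := B - 1) (by omega)
    have h2 : (B - 1) * (B - 1) ≤ (B - 1) * (B - 1 + 1) := Nat.mul_le_mul_left _ (Nat.le_succ _)
    omega
  -- Only B - 1 enters the degree, and minimality of B gives (B - 1)^2 ≤ 8NA.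
  set b : ℝ := ((B - 1 : ℕ) : ℝ) with hb
  have hb0 : 0 ≤ b := Nat.cast_nonneg _
  have hbB : (B : ℝ) = b + 1 := by rw [hb, Nat.cast_sub hB1]; simp
  have hbsq : b ^ 2 ≤ 8 * N * A := by
    rw [sq, hb]; exact_mod_cast hBmin
  have hbx : b ^ 2 * x ^ 3 ≤ T ^ 2 * A := by
    calc b ^ 2 * x ^ 3 ≤ 8 * N * A * x ^ 3 := by gcongr
      _ = 8 * (N : ℝ) * x ^ 3 * A := by ring
      _ = T ^ 2 * A := by rw [hx3]
  have hbTx : b * x ≤ T := by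
    refine le_of_sq_le_sq ?_ hTpos.le
    have h1 : b ^ 2 * x ^ 3 ≤ T ^ 2 * x := hbx.trans (by gcongr)
    have h2 : (b * x) ^ 2 * x ≤ T ^ 2 * x := by
      linarith [h1, show (b * x) ^ 2 * x = b ^ 2 * x ^ 3 by ring]
    exact le_of_mul_le_mul_right h2 hx
  have hABle : A * B ≤ t := by
    have h1 : (A : ℝ) * (b * x) ≤ A * T := by gcongr
    have h2 : (A : ℝ) * (x + T) ≤ x * T := by
      rw [← hqx]; gcongr
    have h3 : (A : ℝ) * B ≤ T := by
      rw [hbB]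
      refine le_of_mul_le_mul_right ?_ hx
      linarith [show (A : ℝ) * (b + 1) * x = A * (b * x) + A * x by ring]
    rw [hT] at h3
    exact_mod_cast h3
  have hPs : 4 * (T * s) ≤ P := by
    refine le_of_sq_le_sq ?_ (Nat.cast_nonneg _)
    have : 16 * T ^ 3 ≤ (P : ℝ) ^ 2 := by rw [hT]; exact_mod_cast htP
    calc (4 * (T * s)) ^ 2 = 16 * (T ^ 2 * s ^ 2) := by ring
      _ = 16 * T ^ 3 := by rw [hs2]; ring
      _ ≤ _ := this
  have hbs : b ≤ 2 * s := by
    have h1 : b * (0.545 * s) ≤ T := le_trans (by gcongr) hbTx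
    rw [← hs2] at h1
    have h2 : b * 0.545 ≤ s := by
      refine le_of_mul_le_mul_right (a := s) ?_ (by linarith)
      nlinarith
    linarith
  have hTs : 13 * T ≤ T * s := by nlinarith
  have hdeg : A - 1 + t * (B - 1) < P := by
    have h1 : (A : ℝ) + T * b < P := by
      have h2 : T * b ≤ T * (2 * s) := by gcongr
      linarith [show T * (2 * s) = 2 * (T * s) by ring]
    have h2 : A + t * (B - 1) < P := by
      rw [hT, hb] at h1; exact_mod_cast h1
    omega
  have hD : 2 * A ≤ P := by
    have h1 : 2 * (A : ℝ) ≤ P := by linarith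
    exact_mod_cast h1
  have hmain := mul_sum_card_consecutive_le' hP W hW hN (by omega) hA1 hABle hdeg hD
    (by rw [← hNdef]; exact Nat.le_succ_of_le hBspec)
  set S := ∑ w ∈ W, #(consecutive t w) with hS
  have hmain' : 2 * (A : ℝ) * S ≤ A + T * b := by
    have : 2 * A * S ≤ A + t * (B - 1) := by omega
    rw [hT, hb]; exact_mod_cast this
  have hApos : (0 : ℝ) < A := by exact_mod_cast hA1
  have hbA : b * x ^ 2 ≤ 1.116 * T * A := by
    refine le_of_sq_le_sq ?_ (by positivity)
    have h1 : (b * x ^ 2) ^ 2 = b ^ 2 * x ^ 3 * x := by ring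
    rw [h1]
    calc b ^ 2 * x ^ 3 * x ≤ T ^ 2 * A * x := by gcongr
      _ ≤ T ^ 2 * A * (A / 0.804) := by
        gcongr
        rw [le_div_iff₀ (by norm_num)]; linarith
      _ ≤ (1.116 * T * A) ^ 2 := by
        have : 0 < T ^ 2 * (A : ℝ) ^ 2 := by positivity
        have e : T ^ 2 * A * (A / 0.804) = T ^ 2 * (A : ℝ) ^ 2 / 0.804 := by ring
        rw [e, div_le_iff₀ (by norm_num)]
        nlinarith
  rw [← mul_div_assoc, le_div_iff₀ (by positivity)]
  refine le_of_mul_le_mul_left (a := 2 * (A : ℝ)) ?_ (by positivity)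
  -- Here 1.116 exceeds 0.804^(-1/2), and 0.0886^2 + 1.116 < 9/8.
  calc 2 * (A : ℝ) * (S * x ^ 2) = 2 * (A : ℝ) * S * x ^ 2 := by ring
    _ ≤ (A + T * b) * x ^ 2 := by gcongr
    _ = A * x ^ 2 + T * (b * x ^ 2) := by ring
    _ ≤ A * (0.0886 * T) ^ 2 + T * (1.116 * T * A) := by gcongr
    _ ≤ 2 * A * (9 / 16 * T ^ 2) := by
      have : 0 < T ^ 2 * (A : ℝ) := by positivity
      linarith [show A * (0.0886 * T) ^ 2 + T * (1.116 * T * A) = 1.12384996 * (T ^ 2 * A) by ring,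
        show 2 * A * (9 / 16 * T ^ 2) = 1.125 * (T ^ 2 * (A : ℝ)) by ring]

end Energy

end GaussPeriod

namespace GaussPeriod

open Finset

/-! ### The bound for the sum of J(w)^2, for small and for large t. -/

section Energy

variable {F : Type*} [Field F] [Fintype F] [DecidableEq F] {P : ℕ}

theorem card_consecutive_le (hP : ∀ m : ℕ, 0 < m → m < P → (m : F) ≠ 0) {t : ℕ}
    (ht : 24 ≤ t) (ht' : t ≤ 190) (htP : 16 * t ^ 3 ≤ P ^ 2) (w : F) (hw : w ≠ 0) :
    9 * (#(consecutive t w) + 1) ^ 2 ≤ 256 * t := by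
  have hPt : 19 * t ≤ P := by
    refine (Nat.pow_le_pow_iff_left two_ne_zero).mp ?_
    calc (19 * t) ^ 2 = 361 * t ^ 2 := by ring
      _ ≤ 16 * t * t ^ 2 := Nat.mul_le_mul_right _ (by omega)
      _ = 16 * t ^ 3 := by ring
      _ ≤ P ^ 2 := htP
  have key : ∀ A B : ℕ, 1 ≤ A → A * B ≤ t → 8 * A ≤ B * (B + 1) + 1 → A ≤ 12 → B ≤ 10 →
      2 * A * #(consecutive t w) ≤ A - 1 + t * (B - 1) := by
    intro A B hA hAB hc hA' hB'
    have h1 : t * (B - 1) ≤ t * 9 := Nat.mul_le_mul_left _ (by omega)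
    simpa using mul_sum_card_consecutive_le' hP (t := t) (A := A) (B := B) {w} (by simpa using hw)
      (by simp) (by omega) hA hAB (by omega) (by omega) (by simpa using hc)
  -- The target is j + 1 ≤ (16/3)√t. Three pairs (A, B) cover the range of t; each resulting
  -- quadratic inequality is convex in t and holds on its interval.
  set j := #(consecutive t w)
  rcases le_or_gt t 66 with h | h
  · have := key 4 6 (by norm_num) (by omega) (by norm_num) (by norm_num) (by norm_num)
    have h1 : 8 * (j + 1) ≤ 5 * t + 11 := by omega
    have h2 := Nat.pow_le_pow_left h1 2
    have h3 : 9 * (5 * t + 11) ^ 2 ≤ 16384 * t := by nlinarith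
    nlinarith
  rcases le_or_gt t 135 with h' | h'
  · have := key 8 8 (by norm_num) (by omega) (by norm_num) (by norm_num) (by norm_num)
    have h1 : 16 * (j + 1) ≤ 7 * t + 23 := by omega
    have h2 := Nat.pow_le_pow_left h1 2
    have h3 : 9 * (7 * t + 23) ^ 2 ≤ 65536 * t := by nlinarith
    nlinarith
  · have := key 12 10 (by norm_num) (by omega) (by norm_num) (by norm_num) (by norm_num)
    have h1 : 24 * (j + 1) ≤ 9 * t + 35 := by omega
    have h2 := Nat.pow_le_pow_left h1 2
    have h3 : 9 * (9 * t + 35) ^ 2 ≤ 147456 * t := by nlinarith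
    nlinarith

/-- The sum of J^2 is at most max J times the sum of J. -/
theorem sum_sq_card_consecutive_le_of_small (hP : ∀ m : ℕ, 0 < m → m < P → (m : F) ≠ 0) {t : ℕ}
    (ht : 24 ≤ t) (ht' : t ≤ 190) (htP : 16 * t ^ 3 ≤ P ^ 2) (htF : (t : F) ≠ 0) :
    9 * (t + ∑ w ∈ univ.erase (0 : F), #(consecutive t w) ^ 2) ^ 2 ≤ 256 * t ^ 3 := by
  have hne : (univ.erase (0 : F)).Nonempty := ⟨1, by simp⟩
  obtain ⟨v, hv, hmax⟩ := Finset.exists_max_image (univ.erase (0 : F))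
    (fun w => #(consecutive t w)) hne
  set j := #(consecutive t v)
  have h1 := card_consecutive_le hP ht ht' htP v (Finset.ne_of_mem_erase hv)
  have h2 := sum_card_consecutive_le (F := F) (t := t) (by omega) htF
  have h3 : ∑ w ∈ univ.erase (0 : F), #(consecutive t w) ^ 2 ≤ j * t := by
    calc _ ≤ ∑ w ∈ univ.erase (0 : F), j * #(consecutive t w) := by
          refine Finset.sum_le_sum fun w hw => ?_
          rw [sq]; exact Nat.mul_le_mul_right _ (hmax w hw)
      _ = j * ∑ w ∈ univ.erase (0 : F), #(consecutive t w) := by rw [Finset.mul_sum]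
      _ ≤ j * t := Nat.mul_le_mul_left _ (by omega)
  calc 9 * (t + ∑ w ∈ univ.erase (0 : F), #(consecutive t w) ^ 2) ^ 2
      ≤ 9 * (t + j * t) ^ 2 := by gcongr
    _ = t ^ 2 * (9 * (j + 1) ^ 2) := by ring
    _ ≤ t ^ 2 * (256 * t) := Nat.mul_le_mul_left _ h1
    _ = 256 * t ^ 3 := by ring

/-- The excess over h is the sum of J over W = {J > h} minus h · #W. Stepanov's bound for W, with #W
= t^2/(8x^3), is then optimised over x by `cubic_bound`. The condition on h gives #W ≤ t/h ≤ √t/1.3,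
as Stepanov's bound requires. -/
theorem sum_excess_le (hP : ∀ m : ℕ, 0 < m → m < P → (m : F) ≠ 0) {t : ℕ}
    (ht : 180 ≤ t) (htP : 16 * t ^ 3 ≤ P ^ 2) (htF : (t : F) ≠ 0) {h : ℕ}
    (hh : 169 * t ≤ 100 * h ^ 2) :
    ((∑ w ∈ univ.erase (0 : F), (#(consecutive t w) - h) : ℕ) : ℝ) ≤
      27 / 16 * ((t : ℝ) ^ 2 / (h : ℝ) ^ 2) := by
  set W := (univ.erase (0 : F)).filter fun w => h < #(consecutive t w) with hW
  have hhpos : 0 < h := by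
    rcases Nat.eq_zero_or_pos h with rfl | h0
    · omega
    · exact h0
  have hsum : ∑ w ∈ univ.erase (0 : F), (#(consecutive t w) - h) + h * #W =
      ∑ w ∈ W, #(consecutive t w) := by
    have h1 : ∑ w ∈ univ.erase (0 : F), (#(consecutive t w) - h) =
        ∑ w ∈ W, (#(consecutive t w) - h) := by
      symm
      refine Finset.sum_subset (Finset.filter_subset _ _) fun w hw hw' => ?_
      have : ¬ h < #(consecutive t w) := fun hlt => hw' (Finset.mem_filter.mpr ⟨hw, hlt⟩)
      omega
    rw [h1, mul_comm, ← smul_eq_mul, ← Finset.sum_const, ← Finset.sum_add_distrib]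
    refine Finset.sum_congr rfl fun w hw => ?_
    have := (Finset.mem_filter.mp hw).2
    omega
  rcases Nat.eq_zero_or_pos #W with h0 | hN
  · have hWe : W = ∅ := Finset.card_eq_zero.mp h0
    rw [h0, hWe, Finset.sum_empty, mul_zero, add_zero] at hsum
    rw [hsum]
    simp only [Nat.cast_zero]
    positivity
  have hle : ∑ w ∈ W, #(consecutive t w) ≤ t := by
    have h1 := sum_card_consecutive_le (F := F) (t := t) (by omega) htF
    have h2 : ∑ w ∈ W, #(consecutive t w) ≤ ∑ w ∈ univ.erase (0 : F), #(consecutive t w) :=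
      Finset.sum_le_sum_of_subset (Finset.filter_subset _ _)
    omega
  have hNt : 169 * #W ^ 2 ≤ 100 * t := by
    have h1 : h * #W ≤ t := by omega
    have h2 := Nat.pow_le_pow_left h1 2
    refine Nat.le_of_mul_le_mul_right (c := t) ?_ (by omega)
    calc 169 * #W ^ 2 * t = #W ^ 2 * (169 * t) := by ring
      _ ≤ #W ^ 2 * (100 * h ^ 2) := Nat.mul_le_mul_left _ hh
      _ = 100 * (h * #W) ^ 2 := by ring
      _ ≤ 100 * t ^ 2 := by omega
      _ = 100 * t * t := by ring
  have hNpos : (0 : ℝ) < #W := by exact_mod_cast hN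
  have htpos : (0 : ℝ) < t := by exact_mod_cast (by omega : 0 < t)
  set y : ℝ := (t : ℝ) ^ 2 / (8 * #W) with hy
  have hypos : 0 < y := by positivity
  set x : ℝ := y ^ ((1 : ℝ) / 3) with hx
  have hxpos : 0 < x := Real.rpow_pos_of_pos hypos _
  have hx3 : x ^ 3 = y := by
    rw [hx, ← Real.rpow_natCast, ← Real.rpow_mul hypos.le]; norm_num
  have hNx : 8 * (#W : ℝ) * x ^ 3 = (t : ℝ) ^ 2 := by
    rw [hx3, hy]; field_simp
  have hS := sum_card_consecutive_le_of_cube hP ht htP W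
    (fun w hw => Finset.ne_of_mem_erase (Finset.mem_filter.mp hw).1) hN hNt hxpos hNx
  rw [← hsum] at hS
  push_cast at hS
  have hNeq : (#W : ℝ) = (t : ℝ) ^ 2 / (8 * x ^ 3) := by
    rw [eq_div_iff (by positivity)]; linarith
  have hcub := cubic_bound (T := (t : ℝ)) hxpos (show (0 : ℝ) < h by exact_mod_cast hhpos)
  rw [← hNeq] at hcub
  push_cast
  linarith

/-- Layer-cake summation of the excesses: the trivial bound below a cut m, `sum_excess_le` above it.
-/
theorem sum_sq_card_consecutive_le_of_large (hP : ∀ m : ℕ, 0 < m → m < P → (m : F) ≠ 0) {t : ℕ}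
    (ht : 180 ≤ t) (htP : 16 * t ^ 3 ≤ P ^ 2) (htF : (t : F) ≠ 0) :
    9 * (t + ∑ w ∈ univ.erase (0 : F), #(consecutive t w) ^ 2) ^ 2 ≤ 256 * t ^ 3 := by
  set J : F → ℕ := fun w => #(consecutive t w) with hJ
  set Z := univ.erase (0 : F) with hZ
  have hsumJ : ∑ w ∈ Z, J w ≤ t - 1 := sum_card_consecutive_le (by omega) htF
  set V : ℕ → ℕ := fun h => ∑ w ∈ Z, (J w - h) with hV
  have hlayer : ∑ w ∈ Z, J w ^ 2 + ∑ w ∈ Z, J w = 2 * ∑ h ∈ range t, V h := by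
    rw [← Finset.sum_add_distrib, hV, Finset.sum_comm, Finset.mul_sum]
    refine Finset.sum_congr rfl fun w hw => sq_add_self_eq_two_mul_sum _ _ ?_
    have := Finset.single_le_sum (f := J) (fun _ _ => Nat.zero_le _) hw
    omega
  set T : ℝ := (t : ℝ) with hT
  have hT180 : (180 : ℝ) ≤ T := by rw [hT]; exact_mod_cast ht
  set s := Real.sqrt T with hs
  have hs2 : s ^ 2 = T := Real.sq_sqrt (by linarith)
  have hs13 : (13.4 : ℝ) ≤ s := Real.le_sqrt_of_sq_le (by norm_num; linarith)
  -- With 2m - 1 = c√t the leading constant is c + 27/(4c), minimal at c = √27/2 ≈ 2.6, where it is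
  -- about 5.2 < 16/3.
  set m := ⌈1.3 * s⌉₊ with hm
  have hm1 : 1.3 * s ≤ m := Nat.le_ceil _
  have hm2 : (m : ℝ) < 1.3 * s + 1 := Nat.ceil_lt_add_one (by linarith)
  have hmpos : 1 ≤ m := by
    have : (1 : ℝ) ≤ m := by linarith
    exact_mod_cast this
  have hmt : m ≤ t := by
    have : (m : ℝ) ≤ T := by nlinarith
    rw [hT] at this; exact_mod_cast this
  have hlow : ∑ h ∈ range m, V h ≤ m * ∑ w ∈ Z, J w := by
    calc _ ≤ ∑ _h ∈ range m, ∑ w ∈ Z, J w :=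
          Finset.sum_le_sum fun h _ => Finset.sum_le_sum fun w _ => Nat.sub_le _ _
      _ = _ := by simp
  have hhigh : ((∑ h ∈ Ico m t, V h : ℕ) : ℝ) ≤ 27 / 16 * T ^ 2 * (2 / (2 * m - 1)) := by
    push_cast
    calc ∑ h ∈ Ico m t, (V h : ℝ) ≤ ∑ h ∈ Ico m t, 27 / 16 * T ^ 2 * (1 / (h : ℝ) ^ 2) := by
          refine Finset.sum_le_sum fun h hh => ?_
          have h1 : (m : ℝ) ≤ h := by exact_mod_cast (Finset.mem_Ico.mp hh).1
          have h2 : 169 * t ≤ 100 * h ^ 2 := by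
            have : (169 : ℝ) * T ≤ 100 * (h : ℝ) ^ 2 := by rw [← hs2]; nlinarith
            rw [hT] at this; exact_mod_cast this
          have := sum_excess_le hP ht htP htF h2
          rw [hV]
          refine this.trans (le_of_eq (by ring))
      _ = 27 / 16 * T ^ 2 * ∑ h ∈ Ico m t, 1 / (h : ℝ) ^ 2 := by rw [Finset.mul_sum]
      _ ≤ _ := by
        have := sum_inv_sq_le m t hmpos
        gcongr
  set Q : ℝ := ((∑ w ∈ Z, J w ^ 2 : ℕ) : ℝ) with hQ
  set R : ℝ := ((∑ w ∈ Z, J w : ℕ) : ℝ) with hR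
  have hRT : R ≤ T - 1 := by
    have : ((∑ w ∈ Z, J w : ℕ) : ℝ) + 1 ≤ t := by exact_mod_cast (by omega)
    rw [hR, hT]; linarith
  set v : ℝ := 2 * m - 1 with hv
  have hvpos : 0 < v := by linarith
  have hQle : Q ≤ v * (T - 1) + 27 / 4 * T ^ 2 / v := by
    have h1 : Q + R = 2 * ((∑ h ∈ range m, V h : ℕ) : ℝ) + 2 * ((∑ h ∈ Ico m t, V h : ℕ) : ℝ) := by
      rw [← Finset.sum_range_add_sum_Ico _ hmt] at hlayer
      rw [hQ, hR]
      have : ((∑ w ∈ Z, J w ^ 2 + ∑ w ∈ Z, J w : ℕ) : ℝ) =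
        ((2 * (∑ h ∈ range m, V h + ∑ h ∈ Ico m t, V h) : ℕ) : ℝ) := by rw [hlayer]
      rw [Nat.cast_add, Nat.cast_mul, Nat.cast_add] at this
      rw [this]; push_cast; ring
    have h2 : ((∑ h ∈ range m, V h : ℕ) : ℝ) ≤ m * R := by rw [hR]; exact_mod_cast hlow
    have h3 : 2 * (27 / 16 * T ^ 2 * (2 / v)) = 27 / 4 * T ^ 2 / v := by ring
    have h4 : v * R ≤ v * (T - 1) := by gcongr
    rw [hv] at h4 h3 ⊢
    linarith
  have hfin : 3 * (T + Q) ≤ 16 * (T * s) := by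
    have h1 : 27 / 4 * T ^ 2 / v ≤ T * (16 / 3 * s - 1 - v) := by
      rw [div_le_iff₀ hvpos]
      have h2 : 27 / 4 * s ^ 2 ≤ (16 / 3 * s - 1 - v) * v := by
        have h5 : 2.6 * s - 1 ≤ v := by linarith
        have h6 : v ≤ 2.6 * s + 1 := by linarith
        have h7 : (v - 2.6 * s) ^ 2 ≤ 1 := by
          rw [sq_le_one_iff_abs_le_one, abs_le]; constructor <;> linarith
        have h8 : 13.4 * v ≤ s * v := by gcongr
        have h9 : 0 ≤ s ^ 2 := sq_nonneg s
        nlinarith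
      calc 27 / 4 * T ^ 2 = T * (27 / 4 * s ^ 2) := by rw [hs2]; ring
        _ ≤ T * ((16 / 3 * s - 1 - v) * v) := by gcongr
        _ = _ := by ring
    linarith [show T * (16 / 3 * s - 1 - v) = 16 / 3 * (T * s) - T - v * T by ring,
      show v * (T - 1) = v * T - v by ring]
  have hQ0 : 0 ≤ Q := Nat.cast_nonneg _
  have hsq : (3 * (T + Q)) ^ 2 ≤ (16 * (T * s)) ^ 2 := pow_le_pow_left₀ (by linarith) hfin 2
  have hcast : 9 * (T + Q) ^ 2 ≤ 256 * T ^ 3 := by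
    calc 9 * (T + Q) ^ 2 = (3 * (T + Q)) ^ 2 := by ring
      _ ≤ (16 * (T * s)) ^ 2 := hsq
      _ = 256 * (T ^ 2 * s ^ 2) := by ring
      _ = 256 * T ^ 3 := by rw [hs2]; ring
  rw [hQ, hT] at hcast
  exact_mod_cast hcast

/-- The additive energy bound in terms of the numbers of solutions of `x^t = (x-1)^t = w`. -/
theorem sum_sq_card_consecutive_le (hP : ∀ m : ℕ, 0 < m → m < P → (m : F) ≠ 0) {t : ℕ}
    (ht : 24 ≤ t) (htP : 16 * t ^ 3 ≤ P ^ 2) (htF : (t : F) ≠ 0) :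
    9 * (t + ∑ w ∈ univ.erase (0 : F), #(consecutive t w) ^ 2) ^ 2 ≤ 256 * t ^ 3 := by
  rcases le_total t 190 with h | h
  · exact sum_sq_card_consecutive_le_of_small hP ht h htP htF
  · exact sum_sq_card_consecutive_le_of_large hP (by omega) htP htF

end Energy

end GaussPeriod

namespace GaussPeriod

open Finset

/-! ### Gaussian periods and additive energy. -/

section Periods

variable {p : ℕ} [Fact p.Prime]

/-- The `t`-th roots of unity modulo `p`. -/
def unityRoots (p t : ℕ) [Fact p.Prime] : Finset (ZMod p) := univ.filter fun x => x ^ t = 1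

/-- The Gaussian period attached to the subgroup of `t`-th roots of unity. -/
noncomputable def period (p t : ℕ) [Fact p.Prime] (a : ZMod p) : ℂ :=
  ∑ h ∈ unityRoots p t, ZMod.stdAddChar (a * h)

/-- The number of representations of `m` as a difference of two `t`-th roots of unity. -/
def diffCount (p t : ℕ) [Fact p.Prime] (m : ZMod p) : ℕ :=
  #((unityRoots p t ×ˢ unityRoots p t).filter fun q => q.1 - q.2 = m)

theorem mem_unityRoots {t : ℕ} {x : ZMod p} : x ∈ unityRoots p t ↔ x ^ t = 1 := by
  simp [unityRoots]

theorem conj_stdAddChar (x : ZMod p) :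
    (starRingEnd ℂ) (ZMod.stdAddChar x) = ZMod.stdAddChar (-x) := by
  rw [ZMod.stdAddChar_apply, ZMod.stdAddChar_apply, ← Circle.coe_inv_eq_conj,
    AddChar.map_neg_eq_inv]

theorem ne_zero_of_mem_unityRoots {t : ℕ} (ht : 1 ≤ t) {x : ZMod p} (hx : x ∈ unityRoots p t) :
    x ≠ 0 := by
  rintro rfl
  rw [mem_unityRoots, zero_pow (by omega)] at hx
  exact zero_ne_one hx

theorem card_filter_pow_eq_le {t : ℕ} (ht : 1 ≤ t) (a : ZMod p) :
    #(univ.filter fun x : ZMod p => x ^ t = a) ≤ t := by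
  classical
  calc _ ≤ #(Polynomial.nthRoots t a).toFinset := by
        refine Finset.card_le_card fun x hx => ?_
        rw [Multiset.mem_toFinset, Polynomial.mem_nthRoots (by omega)]
        exact (Finset.mem_filter.mp hx).2
    _ ≤ _ := Multiset.toFinset_card_le _
    _ ≤ t := Polynomial.card_nthRoots _ _

theorem sum_unityRoots_mul {M : Type*} [AddCommMonoid M] {t : ℕ} (ht : 1 ≤ t) {h : ZMod p}
    (hh : h ∈ unityRoots p t) (f : ZMod p → M) :
    ∑ x ∈ unityRoots p t, f (h * x) = ∑ x ∈ unityRoots p t, f x := by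
  have h0 := ne_zero_of_mem_unityRoots ht hh
  rw [mem_unityRoots] at hh
  refine Finset.sum_bij' (fun x _ => h * x) (fun x _ => h⁻¹ * x) ?_ ?_ ?_ ?_ ?_
  · intro x hx
    rw [mem_unityRoots] at hx ⊢
    rw [mul_pow, hh, hx, one_mul]
  · intro x hx
    rw [mem_unityRoots] at hx ⊢
    rw [mul_pow, inv_pow, hh, hx, inv_one, one_mul]
  · intro x _; exact inv_mul_cancel_left₀ h0 x
  · intro x _; exact mul_inv_cancel_left₀ h0 x
  · intro x _; rfl

theorem period_mul {t : ℕ} (ht : 1 ≤ t) {h : ZMod p} (hh : h ∈ unityRoots p t) (a : ZMod p) :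
    period p t (a * h) = period p t a := by
  unfold period
  rw [← sum_unityRoots_mul ht hh (fun x => (ZMod.stdAddChar (a * x) : ℂ))]
  exact Finset.sum_congr rfl fun x _ => by rw [mul_assoc]

theorem period_zero (t : ℕ) : period p t 0 = #(unityRoots p t) := by
  simp [period]

/-- Parseval's identity on `ZMod p`. -/
theorem sum_norm_sq_fourier (f : ZMod p → ℂ) :
    ∑ b : ZMod p, ‖∑ m : ZMod p, f m * ZMod.stdAddChar (b * m)‖ ^ 2 =
      p * ∑ m : ZMod p, ‖f m‖ ^ 2 := by
  have key : ∑ b : ZMod p, ((‖∑ m : ZMod p, f m * ZMod.stdAddChar (b * m)‖ ^ 2 : ℝ) : ℂ) =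
      p * ∑ m : ZMod p, ((‖f m‖ ^ 2 : ℝ) : ℂ) := by
    calc _ = ∑ b : ZMod p, ∑ m : ZMod p, ∑ m' : ZMod p,
          f m * (starRingEnd ℂ) (f m') * ZMod.stdAddChar (b * (m - m')) := by
          refine Finset.sum_congr rfl fun b _ => ?_
          push_cast
          rw [← Complex.mul_conj', map_sum, Finset.sum_mul_sum]
          refine Finset.sum_congr rfl fun m _ => Finset.sum_congr rfl fun m' _ => ?_
          rw [map_mul (starRingEnd ℂ), conj_stdAddChar, mul_sub, sub_eq_add_neg,
            AddChar.map_add_eq_mul]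
          ring
      _ = ∑ m : ZMod p, ∑ m' : ZMod p, f m * (starRingEnd ℂ) (f m') *
          ∑ b : ZMod p, ZMod.stdAddChar (b * (m - m')) := by
          rw [Finset.sum_comm]
          refine Finset.sum_congr rfl fun m _ => ?_
          rw [Finset.sum_comm]
          exact Finset.sum_congr rfl fun m' _ => by rw [Finset.mul_sum]
      _ = _ := by
          rw [Finset.mul_sum]
          refine Finset.sum_congr rfl fun m _ => ?_
          rw [Finset.sum_eq_single m]
          · rw [AddChar.sum_mulShift _ (ZMod.isPrimitive_stdAddChar p), if_pos (sub_self m),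
              ZMod.card, Complex.mul_conj']
            push_cast; ring
          · intro m' _ hm
            rw [AddChar.sum_mulShift _ (ZMod.isPrimitive_stdAddChar p),
              if_neg (sub_ne_zero.mpr hm.symm)]
            simp
          · simp
  exact_mod_cast key

theorem sum_norm_sq_period (t : ℕ) :
    ∑ b : ZMod p, ‖period p t b‖ ^ 2 = p * #(unityRoots p t) := by
  have h := sum_norm_sq_fourier (fun m : ZMod p => if m ∈ unityRoots p t then (1 : ℂ) else 0)
  have h1 : ∀ b : ZMod p, ∑ m : ZMod p, (if m ∈ unityRoots p t then (1 : ℂ) else 0) *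
      ZMod.stdAddChar (b * m) = period p t b := by
    intro b
    simp [period, Finset.sum_ite_mem]
  simp only [h1] at h
  rw [h]
  congr 1
  have h2 : ∀ m : ZMod p, ‖(if m ∈ unityRoots p t then (1 : ℂ) else 0)‖ ^ 2 =
      if m ∈ unityRoots p t then (1 : ℝ) else 0 := by
    intro m; split_ifs <;> simp
  simp [h2, Finset.sum_ite_mem]

theorem sum_sub_eq_sum_diffCount {M : Type*} [AddCommMonoid M] (t : ℕ) (f : ZMod p → M) :
    ∑ x ∈ unityRoots p t, ∑ y ∈ unityRoots p t, f (x - y) =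
      ∑ m : ZMod p, diffCount p t m • f m := by
  rw [← Finset.sum_product', ← Finset.sum_fiberwise_of_maps_to
    (t := (univ : Finset (ZMod p))) (g := fun q : ZMod p × ZMod p => q.1 - q.2)
    (fun _ _ => mem_univ _)]
  refine Finset.sum_congr rfl fun m _ => ?_
  rw [diffCount, ← Finset.sum_const]
  exact Finset.sum_congr rfl fun q hq => by rw [(Finset.mem_filter.mp hq).2]

theorem norm_sq_period (t : ℕ) (a : ZMod p) :
    ((‖period p t a‖ ^ 2 : ℝ) : ℂ) =
      ∑ x ∈ unityRoots p t, ∑ y ∈ unityRoots p t, ZMod.stdAddChar (a * (x - y)) := by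
  push_cast
  rw [← Complex.mul_conj', period, map_sum, Finset.sum_mul_sum]
  refine Finset.sum_congr rfl fun m _ => Finset.sum_congr rfl fun m' _ => ?_
  rw [conj_stdAddChar, mul_sub, sub_eq_add_neg, AddChar.map_add_eq_mul]

theorem norm_sq_period_eq_sum_diffCount (t : ℕ) (a : ZMod p) :
    ((‖period p t a‖ ^ 2 : ℝ) : ℂ) =
      ∑ m : ZMod p, (diffCount p t m : ℂ) * ZMod.stdAddChar (a * m) := by
  rw [norm_sq_period, sum_sub_eq_sum_diffCount t (fun m => (ZMod.stdAddChar (a * m) : ℂ))]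
  simp

theorem sum_norm_pow_four_period (t : ℕ) :
    ∑ b : ZMod p, ‖period p t b‖ ^ 4 = p * ∑ m : ZMod p, (diffCount p t m : ℝ) ^ 2 := by
  have h := sum_norm_sq_fourier (fun m : ZMod p => (diffCount p t m : ℂ))
  simp only [← norm_sq_period_eq_sum_diffCount] at h
  simp only [Complex.norm_natCast, Complex.norm_real] at h
  rw [← h]
  refine Finset.sum_congr rfl fun b _ => ?_
  rw [Real.norm_of_nonneg (by positivity)]; ring

theorem sum_diffCount (t : ℕ) : ∑ m : ZMod p, diffCount p t m = #(unityRoots p t) ^ 2 := by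
  have := sum_sub_eq_sum_diffCount (p := p) t (fun _ => 1)
  simp only [Finset.sum_const, smul_eq_mul, mul_one] at this
  rw [← this, sq]

/-- The period takes the same value at the t points of a coset, and its total square mass is pt. -/
theorem norm_sq_period_le {t : ℕ} (ht : 1 ≤ t) (hcard : #(unityRoots p t) = t) {a : ZMod p}
    (ha : a ≠ 0) : ‖period p t a‖ ^ 2 ≤ p := by
  have h1 : (t : ℝ) * ‖period p t a‖ ^ 2 = ∑ h ∈ unityRoots p t, ‖period p t (a * h)‖ ^ 2 := by
    rw [Finset.sum_congr rfl fun h hh => by rw [period_mul ht hh], Finset.sum_const, hcard,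
      nsmul_eq_mul]
  have h2 : ∑ h ∈ unityRoots p t, ‖period p t (a * h)‖ ^ 2 ≤
      ∑ b : ZMod p, ‖period p t b‖ ^ 2 := by
    rw [← Fintype.sum_bijective (fun h => a * h) (mulLeft_bijective₀ a ha)
      (fun h => ‖period p t (a * h)‖ ^ 2) (fun b => ‖period p t b‖ ^ 2) (fun _ => rfl)]
    exact Finset.sum_le_sum_of_subset_of_nonneg (Finset.subset_univ _) fun _ _ _ => by positivity
  rw [sum_norm_sq_period, hcard, ← h1, mul_comm (p : ℝ)] at h2
  have htpos : (0 : ℝ) < t := by exact_mod_cast ht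
  exact le_of_mul_le_mul_left h2 htpos

/-- Averaging |T(ah)|^2 over the subgroup gives t|T(a)|^2 = Σ r(m) T(am), with r the difference
count. Apply Cauchy-Schwarz twice, using Σ r = t^2 and Σ |T|^4 = pE. -/
theorem norm_period_pow_eight_le {t : ℕ} (ht : 1 ≤ t) (hcard : #(unityRoots p t) = t)
    {a : ZMod p} (ha : a ≠ 0) :
    ‖period p t a‖ ^ 8 ≤ p * ((∑ m : ZMod p, diffCount p t m ^ 2 : ℕ) : ℝ) ^ 2 := by
  set r : ZMod p → ℝ := fun m => diffCount p t m with hr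
  set E : ℝ := ∑ m : ZMod p, r m ^ 2 with hE
  set N : ZMod p → ℝ := fun m => ‖period p t (a * m)‖ with hN
  have htpos : (0 : ℝ) < t := by exact_mod_cast ht
  have hr0 : ∀ m, 0 ≤ r m := fun m => Nat.cast_nonneg _
  have h1 : (t : ℝ) * ‖period p t a‖ ^ 2 ≤ ∑ m, r m * N m := by
    have h2 : (((t : ℝ) * ‖period p t a‖ ^ 2 : ℝ) : ℂ) =
        ∑ m : ZMod p, (diffCount p t m : ℂ) * period p t (a * m) := by
      have h3 : ∑ h ∈ unityRoots p t, ((‖period p t (a * h)‖ ^ 2 : ℝ) : ℂ) =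
          (((t : ℝ) * ‖period p t a‖ ^ 2 : ℝ) : ℂ) := by
        rw [Finset.sum_congr rfl fun h hh => by rw [period_mul ht hh], Finset.sum_const, hcard,
          nsmul_eq_mul]
        push_cast; ring
      rw [← h3, Finset.sum_congr rfl fun h _ => norm_sq_period_eq_sum_diffCount t (a * h),
        Finset.sum_comm]
      refine Finset.sum_congr rfl fun m _ => ?_
      rw [period, Finset.mul_sum]
      exact Finset.sum_congr rfl fun h _ => by rw [mul_right_comm]
    have h4 := congrArg norm h2
    rw [Complex.norm_real, Real.norm_of_nonneg (by positivity)] at h4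
    rw [h4]
    refine (norm_sum_le _ _).trans (le_of_eq (Finset.sum_congr rfl fun m _ => ?_))
    rw [norm_mul, Complex.norm_natCast]
  have hsum : ∑ m, r m = (t : ℝ) ^ 2 := by
    have := sum_diffCount (p := p) t
    rw [hcard] at this
    simp only [hr]; exact_mod_cast this
  have h2 : (∑ m, r m * N m) ^ 2 ≤ (t : ℝ) ^ 2 * ∑ m, r m * N m ^ 2 := by
    rw [← hsum]
    refine Finset.sum_sq_le_sum_mul_sum_of_sq_le_mul _ (fun m _ => hr0 m)
      (fun m _ => mul_nonneg (hr0 m) (sq_nonneg _)) fun m _ => le_of_eq (by ring)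
  have h3 : (∑ m, r m * N m ^ 2) ^ 2 ≤ E * ∑ m, N m ^ 4 := by
    refine Finset.sum_sq_le_sum_mul_sum_of_sq_le_mul _ (fun m _ => sq_nonneg _)
      (fun m _ => by positivity) fun m _ => le_of_eq (by ring)
  have h4 : ∑ m, N m ^ 4 = p * E := by
    rw [hE, hr, ← sum_norm_pow_four_period]
    exact Fintype.sum_bijective (fun h => a * h) (mulLeft_bijective₀ a ha) _ _ (fun _ => rfl)
  rw [h4] at h3
  have h5 : ((t : ℝ) * ‖period p t a‖ ^ 2) ^ 4 ≤ (t : ℝ) ^ 4 * (E * (p * E)) := by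
    calc ((t : ℝ) * ‖period p t a‖ ^ 2) ^ 4 ≤ (∑ m, r m * N m) ^ 4 := by
          gcongr
      _ = ((∑ m, r m * N m) ^ 2) ^ 2 := by ring
      _ ≤ ((t : ℝ) ^ 2 * ∑ m, r m * N m ^ 2) ^ 2 := by gcongr
      _ = (t : ℝ) ^ 4 * (∑ m, r m * N m ^ 2) ^ 2 := by ring
      _ ≤ _ := by gcongr
  have h6 : ((∑ m : ZMod p, diffCount p t m ^ 2 : ℕ) : ℝ) = E := by
    rw [hE, hr]; push_cast; rfl
  rw [h6]
  refine le_of_mul_le_mul_left (a := (t : ℝ) ^ 4) ?_ (by positivity)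
  linarith [show ((t : ℝ) * ‖period p t a‖ ^ 2) ^ 4 = (t : ℝ) ^ 4 * ‖period p t a‖ ^ 8 by ring,
    show (t : ℝ) ^ 4 * (E * (p * E)) = (t : ℝ) ^ 4 * (p * E ^ 2) by ring]

/-- Divide x - y = m by m: then x/m and x/m - 1 = y/m have the same t-th power. -/
theorem diffCount_le_card_consecutive {t : ℕ} {m : ZMod p} (hm : m ≠ 0) :
    diffCount p t m ≤ #(consecutive t (m ^ t)⁻¹) := by
  refine Finset.card_le_card_of_injOn (fun q => q.1 * m⁻¹) ?_ ?_
  · intro q hq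
    simp only [coe_filter, mem_product, mem_unityRoots, Set.mem_ofPred_eq] at hq
    obtain ⟨⟨h1, h2⟩, h3⟩ := hq
    have h4 : q.1 * m⁻¹ - 1 = q.2 * m⁻¹ := by
      rw [← h3] at hm ⊢
      field_simp
      ring
    simp only [consecutive, coe_filter, mem_univ, true_and, Set.mem_ofPred_eq]
    rw [h4, mul_pow, mul_pow, h1, h2, one_mul, inv_pow]
    exact ⟨rfl, rfl⟩
  · rintro ⟨x, y⟩ hq ⟨x', y'⟩ hq' h
    simp only [coe_filter, Set.mem_ofPred_eq] at hq hq'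
    have h1 : x = x' := mul_right_cancel₀ (inv_ne_zero hm) h
    have h2 : y = y' := by
      have e1 := hq.2
      have e2 := hq'.2
      rw [h1] at e1
      linear_combination e2 - e1
    rw [h1, h2]

theorem diffCount_zero (t : ℕ) : diffCount p t 0 = #(unityRoots p t) := by
  rw [diffCount, ← Finset.card_image_of_injective (unityRoots p t)
    (f := fun x : ZMod p => (x, x)) (fun x y h => (Prod.ext_iff.mp h).1)]
  congr 1
  ext ⟨x, y⟩
  simp only [mem_filter, mem_product, mem_image, Prod.mk.injEq, sub_eq_zero]
  constructor
  · rintro ⟨⟨hx, _⟩, h⟩; exact ⟨x, hx, rfl, h⟩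
  · rintro ⟨z, hz, rfl, rfl⟩; exact ⟨⟨hz, hz⟩, rfl⟩

/-- The term m = 0 gives t^2, and each w equals m^(-t) for at most t values of m. -/
theorem sum_sq_diffCount_le {t : ℕ} (ht : 1 ≤ t) (hcard : #(unityRoots p t) = t) :
    ∑ m : ZMod p, diffCount p t m ^ 2 ≤
      t * (t + ∑ w ∈ univ.erase (0 : ZMod p), #(consecutive t w) ^ 2) := by
  rw [← Finset.add_sum_erase univ _ (mem_univ (0 : ZMod p)), diffCount_zero, hcard, mul_add, ← sq]
  refine Nat.add_le_add_left ?_ _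
  calc ∑ m ∈ univ.erase (0 : ZMod p), diffCount p t m ^ 2
      ≤ ∑ m ∈ univ.erase (0 : ZMod p), #(consecutive t (m ^ t)⁻¹) ^ 2 :=
        Finset.sum_le_sum fun m hm =>
          Nat.pow_le_pow_left (diffCount_le_card_consecutive (Finset.ne_of_mem_erase hm)) 2
    _ = ∑ w ∈ univ.erase (0 : ZMod p),
          ∑ m ∈ (univ.erase (0 : ZMod p)).filter (fun m => (m ^ t)⁻¹ = w),
            #(consecutive t (m ^ t)⁻¹) ^ 2 := by
        rw [Finset.sum_fiberwise_of_maps_to]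
        intro m hm
        exact Finset.mem_erase.mpr
          ⟨inv_ne_zero (pow_ne_zero _ (Finset.ne_of_mem_erase hm)), mem_univ _⟩
    _ ≤ ∑ w ∈ univ.erase (0 : ZMod p), t * #(consecutive t w) ^ 2 := by
        refine Finset.sum_le_sum fun w _ => ?_
        rw [Finset.sum_congr rfl fun m hm => by rw [(Finset.mem_filter.mp hm).2],
          Finset.sum_const, smul_eq_mul]
        refine Nat.mul_le_mul_right _ (le_trans (Finset.card_le_card fun m hm => ?_)
          (card_filter_pow_eq_le ht w⁻¹))
        rw [Finset.mem_filter] at hm ⊢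
        exact ⟨mem_univ _, by rw [← hm.2, inv_inv]⟩
    _ = _ := by rw [Finset.mul_sum]

theorem natCast_ne_zero_of_lt (m : ℕ) (h0 : 0 < m) (hm : m < p) : (m : ZMod p) ≠ 0 := by
  rw [Ne, ZMod.natCast_eq_zero_iff]
  exact fun h => absurd (Nat.le_of_dvd h0 h) (by omega)

theorem norm_period_pow_eight_le_of_energy {t : ℕ} (ht : 24 ≤ t) (htp : t < p)
    (hp : 16 * t ^ 3 ≤ p ^ 2) (hcard : #(unityRoots p t) = t) {a : ZMod p} (ha : a ≠ 0) :
    9 * ‖period p t a‖ ^ 8 ≤ 256 * (p * (t : ℝ) ^ 5) := by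
  have h1 := norm_period_pow_eight_le (by omega) hcard ha
  have h2 := sum_sq_diffCount_le (by omega) hcard
  have h3 := sum_sq_card_consecutive_le (F := ZMod p) (natCast_ne_zero_of_lt) ht hp
    (natCast_ne_zero_of_lt t (by omega) htp)
  have h4 : 9 * (∑ m : ZMod p, diffCount p t m ^ 2) ^ 2 ≤ 256 * t ^ 5 := by
    calc _ ≤ 9 * (t * (t + ∑ w ∈ univ.erase (0 : ZMod p), #(consecutive t w) ^ 2)) ^ 2 := by
          gcongr
      _ = t ^ 2 * (9 * (t + ∑ w ∈ univ.erase (0 : ZMod p), #(consecutive t w) ^ 2) ^ 2) := by ring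
      _ ≤ t ^ 2 * (256 * t ^ 3) := Nat.mul_le_mul_left _ h3
      _ = _ := by ring
  have h5 : 9 * ((∑ m : ZMod p, diffCount p t m ^ 2 : ℕ) : ℝ) ^ 2 ≤ 256 * (t : ℝ) ^ 5 := by
    exact_mod_cast h4
  calc 9 * ‖period p t a‖ ^ 8
      ≤ 9 * (p * ((∑ m : ZMod p, diffCount p t m ^ 2 : ℕ) : ℝ) ^ 2) := by gcongr
    _ = p * (9 * ((∑ m : ZMod p, diffCount p t m ^ 2 : ℕ) : ℝ) ^ 2) := by ring
    _ ≤ p * (256 * (t : ℝ) ^ 5) := by gcongr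
    _ = _ := by ring

/-- The bound `d |T| ≤ 2 * 3^(-1/4) * p^(3/4) * d^(3/8)`, raised to the eighth power. -/
theorem norm_period_pow_eight_le_of_index {d t : ℕ} (hdt : d * t = p - 1)
    (hd : 256 * d ^ 3 < 9 * p ^ 2) (hcard : #(unityRoots p t) = t) {a : ZMod p} (ha : a ≠ 0) :
    9 * (d : ℝ) ^ 5 * ‖period p t a‖ ^ 8 ≤ 256 * (p : ℝ) ^ 6 := by
  have hp2 := (Fact.out : p.Prime).two_le
  have hd1 : 1 ≤ d := by
    rcases Nat.eq_zero_or_pos d with h | h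
    · rw [h] at hdt; omega
    · exact h
  have ht1 : 1 ≤ t := by
    rcases Nat.eq_zero_or_pos t with h | h
    · rw [h] at hdt; omega
    · exact h
  -- In the first case |T| ≤ √p suffices. In the second, t is of order at most p^(3/5), so
  -- Stepanov's condition 16 t^3 ≤ p^2 holds.
  rcases le_or_gt (9 * d ^ 5) (256 * p ^ 2) with hc | hc
  · have h1 := norm_sq_period_le ht1 hcard ha
    have hc' : 9 * (d : ℝ) ^ 5 ≤ 256 * (p : ℝ) ^ 2 := by exact_mod_cast hc
    calc 9 * (d : ℝ) ^ 5 * ‖period p t a‖ ^ 8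
        = 9 * (d : ℝ) ^ 5 * (‖period p t a‖ ^ 2) ^ 4 := by ring
      _ ≤ 256 * (p : ℝ) ^ 2 * (p : ℝ) ^ 4 := by gcongr
      _ = _ := by ring
  -- The lower bound on d^5 and the upper bound on d^3 are compatible only for p > (256/9)^2; such a
  -- p excludes t ≤ 23.
  · have hp809 : 256 ^ 2 < 9 ^ 2 * p := by
      have e1 : (256 * p ^ 2) ^ 3 < (9 * d ^ 5) ^ 3 := Nat.pow_lt_pow_left hc (by norm_num)
      have e2 : (256 * d ^ 3) ^ 5 < (9 * p ^ 2) ^ 5 := Nat.pow_lt_pow_left hd (by norm_num)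
      have e3 : (256 ^ 2) ^ 4 * p ^ 6 < (9 ^ 2 * p) ^ 4 * p ^ 6 := by
        calc (256 ^ 2) ^ 4 * p ^ 6 = 256 ^ 5 * (256 * p ^ 2) ^ 3 := by ring
          _ < 256 ^ 5 * (9 * d ^ 5) ^ 3 := by gcongr
          _ = 9 ^ 3 * (256 * d ^ 3) ^ 5 := by ring
          _ < 9 ^ 3 * (9 * p ^ 2) ^ 5 := by gcongr
          _ = _ := by ring
      have e4 := lt_of_mul_lt_mul_right e3 (Nat.zero_le _)
      exact lt_of_pow_lt_pow_left₀ 4 (Nat.zero_le _) e4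
    have hdt' : d * t < p := by omega
    have ht24 : 24 ≤ t := by
      by_contra! h
      have e1 : p - 1 ≤ d * 23 := by rw [← hdt]; exact Nat.mul_le_mul_left _ (by omega)
      have e2 : (p - 1) ^ 3 ≤ (d * 23) ^ 3 := Nat.pow_le_pow_left e1 3
      obtain ⟨k, rfl⟩ : ∃ k, p = k + 801 := ⟨p - 801, by omega⟩
      simp only [show k + 801 - 1 = k + 800 by omega] at e2
      have e3 : 256 * (k + 800) ^ 3 < 9 * 23 ^ 3 * (k + 801) ^ 2 := by
        calc 256 * (k + 800) ^ 3 ≤ 256 * (d * 23) ^ 3 := by gcongr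
          _ = 23 ^ 3 * (256 * d ^ 3) := by ring
          _ < 23 ^ 3 * (9 * (k + 801) ^ 2) := by gcongr
          _ = _ := by ring
      nlinarith
    have htd : 256 * t ^ 5 ≤ 9 * p ^ 3 := by
      have e1 : (d * t) ^ 5 ≤ p ^ 5 := Nat.pow_le_pow_left hdt'.le 5
      refine Nat.le_of_mul_le_mul_right (c := p ^ 2) ?_ (by positivity)
      calc 256 * t ^ 5 * p ^ 2 = t ^ 5 * (256 * p ^ 2) := by ring
        _ ≤ t ^ 5 * (9 * d ^ 5) := Nat.mul_le_mul_left _ hc.le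
        _ = 9 * (d * t) ^ 5 := by ring
        _ ≤ 9 * p ^ 5 := Nat.mul_le_mul_left _ e1
        _ = _ := by ring
    have hpt : 16 * t ^ 3 ≤ p ^ 2 := by
      refine (Nat.pow_le_pow_iff_left (n := 3) (by norm_num)).mp ?_
      refine Nat.le_of_mul_le_mul_left ?_ (show 0 < 81 by norm_num)
      calc 81 * (16 * t ^ 3) ^ 3 = 331776 * t ^ 9 := by ring
        _ ≤ 65536 * t * t ^ 9 := Nat.mul_le_mul_right _ (by omega)
        _ = (256 * t ^ 5) ^ 2 := by ring
        _ ≤ (9 * p ^ 3) ^ 2 := Nat.pow_le_pow_left htd 2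
        _ = _ := by ring
    have htp : t < p := lt_of_le_of_lt (Nat.le_mul_of_pos_left t hd1) hdt'
    have hE := norm_period_pow_eight_le_of_energy ht24 htp hpt hcard ha
    have hdt'' : (d : ℝ) * t ≤ p := by exact_mod_cast hdt'.le
    calc 9 * (d : ℝ) ^ 5 * ‖period p t a‖ ^ 8 = (d : ℝ) ^ 5 * (9 * ‖period p t a‖ ^ 8) := by ring
      _ ≤ (d : ℝ) ^ 5 * (256 * (p * (t : ℝ) ^ 5)) := by gcongr
      _ = 256 * p * ((d : ℝ) * t) ^ 5 := by ring
      _ ≤ 256 * p * (p : ℝ) ^ 5 := by gcongr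
      _ = _ := by ring

end Periods

end GaussPeriod

namespace GaussPeriod

open Finset

/-! ### Parametrisation by a generator, and the bound from sums of squares. -/

section Generator

theorem sum_range_mul_of_periodic {M : Type*} [AddCommMonoid M] (f : ℕ → M) (t : ℕ)
    (hf : ∀ k, f (k + t) = f k) (d : ℕ) :
    ∑ k ∈ range (d * t), f k = d • ∑ k ∈ range t, f k := by
  have hf' : ∀ m k, f (m * t + k) = f k := by
    intro m
    induction m with
    | zero => simp
    | succ m ih =>
      intro k
      rw [show (m + 1) * t + k = (m * t + k) + t by ring, hf, ih]
  induction d with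
  | zero => simp
  | succ d ih =>
    rw [Nat.succ_mul, Finset.sum_range_add, ih, succ_nsmul]
    simp only [hf']

theorem sum_Icc_one_of_periodic {M : Type*} [AddCommMonoid M] (f : ℕ → M) (t : ℕ)
    (hf : ∀ k, f (k + t) = f k) : ∑ k ∈ Icc 1 t, f k = ∑ k ∈ range t, f k := by
  have h1 : ∑ k ∈ Icc 1 t, f k = ∑ k ∈ range t, f (k + 1) := by
    rw [Finset.range_eq_Ico, Finset.sum_Ico_add' f 0 t 1]
    rfl
  rw [h1]
  rcases t with _ | t
  · simp
  · rw [Finset.sum_range_succ, Finset.sum_range_succ' f]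
    congr 1
    simpa using hf 0

variable {p : ℕ} [Fact p.Prime] {g : (ZMod p)ˣ}

theorem orderOf_generator (hg : ∀ u : (ZMod p)ˣ, u ∈ Subgroup.zpowers g) :
    orderOf g = p - 1 := by
  rw [orderOf_eq_card_of_forall_mem_zpowers hg, Nat.card_eq_fintype_card, ZMod.card_units]

theorem coe_generator_pow_injOn (hg : ∀ u : (ZMod p)ˣ, u ∈ Subgroup.zpowers g) {i j : ℕ}
    (hi : i < p - 1) (hj : j < p - 1) (h : (g : ZMod p) ^ i = (g : ZMod p) ^ j) : i = j := by
  have h1 : g ^ i = g ^ j := Units.ext (by simpa using h)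
  rw [← orderOf_generator hg] at hi hj
  exact pow_injOn_Iio_orderOf hi hj h1

theorem coe_generator_pow_card_sub_one : (g : ZMod p) ^ (p - 1) = 1 :=
  ZMod.pow_card_sub_one_eq_one g.ne_zero

theorem sum_erase_zero_eq_sum_range (hg : ∀ u : (ZMod p)ˣ, u ∈ Subgroup.zpowers g)
    {M : Type*} [AddCommMonoid M] (f : ZMod p → M) :
    ∑ x ∈ univ.erase (0 : ZMod p), f x = ∑ k ∈ range (p - 1), f ((g : ZMod p) ^ k) := by
  have hinj : Set.InjOn (fun k => (g : ZMod p) ^ k) (range (p - 1) : Set ℕ) := by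
    intro i hi j hj h
    exact coe_generator_pow_injOn hg (by simpa using hi) (by simpa using hj) h
  have himg : (range (p - 1)).image (fun k => (g : ZMod p) ^ k) = univ.erase (0 : ZMod p) := by
    refine Finset.eq_of_subset_of_card_le (fun x hx => ?_) ?_
    · obtain ⟨k, _, rfl⟩ := Finset.mem_image.mp hx
      exact Finset.mem_erase.mpr ⟨pow_ne_zero _ g.ne_zero, mem_univ _⟩
    · rw [Finset.card_image_of_injOn hinj, Finset.card_erase_of_mem (mem_univ _), card_range,
        Finset.card_univ, ZMod.card]
  rw [← himg, Finset.sum_image hinj]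

theorem exists_generator_pow (hg : ∀ u : (ZMod p)ˣ, u ∈ Subgroup.zpowers g) {b : ZMod p}
    (hb : b ≠ 0) : ∃ k : ℕ, (g : ZMod p) ^ k = b := by
  obtain ⟨k, hk⟩ := (mem_powers_iff_mem_zpowers (x := g) (y := Units.mk0 b hb)).mpr (hg _)
  exact ⟨k, by simpa using congrArg (Units.val) hk⟩

theorem image_range_eq_unityRoots (hg : ∀ u : (ZMod p)ˣ, u ∈ Subgroup.zpowers g) {d t : ℕ}
    (hd : 1 ≤ d) (ht : 1 ≤ t) (hdt : d * t = p - 1) :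
    Set.InjOn (fun k => (g : ZMod p) ^ (d * k)) (range t : Set ℕ) ∧
      (range t).image (fun k => (g : ZMod p) ^ (d * k)) = unityRoots p t := by
  have hinj : Set.InjOn (fun k => (g : ZMod p) ^ (d * k)) (range t : Set ℕ) := by
    intro i hi j hj h
    simp only [coe_range, Set.mem_Iio] at hi hj
    have := coe_generator_pow_injOn hg
      (by rw [← hdt]; exact Nat.mul_lt_mul_of_pos_left hi hd)
      (by rw [← hdt]; exact Nat.mul_lt_mul_of_pos_left hj hd) h
    exact Nat.eq_of_mul_eq_mul_left hd this
  refine ⟨hinj, Finset.eq_of_subset_of_card_le (fun x hx => ?_) ?_⟩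
  · obtain ⟨k, _, rfl⟩ := Finset.mem_image.mp hx
    rw [mem_unityRoots, ← pow_mul, show d * k * t = (d * t) * k by ring, hdt, pow_mul,
      coe_generator_pow_card_sub_one, one_pow]
  · rw [Finset.card_image_of_injOn hinj, card_range]
    exact card_filter_pow_eq_le ht 1

theorem card_unityRoots (hg : ∀ u : (ZMod p)ˣ, u ∈ Subgroup.zpowers g) {d t : ℕ}
    (hd : 1 ≤ d) (ht : 1 ≤ t) (hdt : d * t = p - 1) : #(unityRoots p t) = t := by
  obtain ⟨hinj, himg⟩ := image_range_eq_unityRoots hg hd ht hdt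
  rw [← himg, Finset.card_image_of_injOn hinj, card_range]

theorem generator_pow_periodic {d t : ℕ} (hdt : d * t = p - 1) (k : ℕ) :
    (g : ZMod p) ^ (d * (k + t)) = (g : ZMod p) ^ (d * k) := by
  rw [mul_add, hdt, pow_add, coe_generator_pow_card_sub_one, mul_one]

theorem sum_unityRoots_eq_sum_range (hg : ∀ u : (ZMod p)ˣ, u ∈ Subgroup.zpowers g) {d t : ℕ}
    (hd : 1 ≤ d) (ht : 1 ≤ t) (hdt : d * t = p - 1) {M : Type*} [AddCommMonoid M]
    (f : ZMod p → M) :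
    ∑ x ∈ unityRoots p t, f x = ∑ k ∈ range t, f ((g : ZMod p) ^ (d * k)) := by
  obtain ⟨hinj, himg⟩ := image_range_eq_unityRoots hg hd ht hdt
  rw [← himg, Finset.sum_image hinj]

/-- On nonzero residues the d-th power map is d-to-one onto the subgroup of order t. -/
theorem sum_pow_eq_sum_unityRoots (hg : ∀ u : (ZMod p)ˣ, u ∈ Subgroup.zpowers g) {d t : ℕ}
    (hd : 1 ≤ d) (ht : 1 ≤ t) (hdt : d * t = p - 1) {M : Type*} [AddCommMonoid M]
    (f : ZMod p → M) :
    ∑ x : ZMod p, f (x ^ d) = f 0 + d • ∑ h ∈ unityRoots p t, f h := by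
  rw [← Finset.add_sum_erase univ _ (mem_univ (0 : ZMod p)), zero_pow (by omega),
    sum_erase_zero_eq_sum_range hg, sum_unityRoots_eq_sum_range hg hd ht hdt, ← hdt]
  congr 1
  rw [sum_range_mul_of_periodic (fun k => f (((g : ZMod p) ^ k) ^ d)) t]
  · simp only [← pow_mul, mul_comm d]
  · intro k
    rw [← pow_mul, ← pow_mul, mul_comm, generator_pow_periodic hdt, mul_comm]

theorem S_eq (hg : ∀ u : (ZMod p)ˣ, u ∈ Subgroup.zpowers g) {d t : ℕ}
    (hd : 1 ≤ d) (ht : 1 ≤ t) (hdt : d * t = p - 1) (a : ℤ) :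
    Stechkin.S d a p = 1 + d * period p t (a : ZMod p) := by
  have h1 : Stechkin.S d a p = ∑ x : ZMod p, ZMod.stdAddChar ((a : ZMod p) * x ^ d) := by
    rw [Stechkin.S, ← Finset.sum_nbij' (s := (univ : Finset (ZMod p))) (t := range p)
      (f := fun x => (ZMod.stdAddChar ((a : ZMod p) * x ^ d) : ℂ))
      (i := fun x => x.val) (j := fun k => (k : ZMod p))]
    · intro x _; exact mem_range.mpr (ZMod.val_lt x)
    · intro k _; exact mem_univ _
    · intro x _; exact ZMod.natCast_zmod_val x
    · intro k hk; exact ZMod.val_cast_of_lt (mem_range.mp hk)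
    · intro x _
      have : (a : ZMod p) * x ^ d = ((a * (x.val : ℤ) ^ d : ℤ) : ZMod p) := by
        push_cast; rw [ZMod.natCast_zmod_val]
      rw [this, ZMod.stdAddChar_coe]
      congr 1
      push_cast
      ring
  rw [h1, sum_pow_eq_sum_unityRoots hg hd ht hdt
    (fun y => (ZMod.stdAddChar ((a : ZMod p) * y) : ℂ)), period, mul_zero,
    AddChar.map_zero_eq_one, nsmul_eq_mul]

theorem exists_period_eq_sum_Icc (hg : ∀ u : (ZMod p)ˣ, u ∈ Subgroup.zpowers g) {d t : ℕ}
    (hd : 1 ≤ d) (ht : 1 ≤ t) (hdt : d * t = p - 1) {b : ZMod p} (hb : b ≠ 0) :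
    ∃ y, 1 ≤ y ∧ y ≤ d ∧
      period p t b = ∑ x ∈ Icc 1 t, ZMod.stdAddChar ((g : ZMod p) ^ (d * x + y)) := by
  obtain ⟨k, hk⟩ := exists_generator_pow hg hb
  have hp1 : 1 ≤ p - 1 := by rw [← hdt]; exact Nat.one_le_iff_ne_zero.mpr (by positivity)
  -- The shift by p - 1 makes j positive, so that j - 1 is not truncated and y lands in 1, ..., d.
  set j := k + (p - 1) with hj
  refine ⟨(j - 1) % d + 1, by omega, Nat.mod_lt _ hd, ?_⟩
  set y := (j - 1) % d + 1 with hy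
  have hjy : j = y + d * ((j - 1) / d) := by
    have := Nat.mod_add_div (j - 1) d
    omega
  have hb' : b = (g : ZMod p) ^ y * (g : ZMod p) ^ (d * ((j - 1) / d)) := by
    rw [← pow_add, ← hjy, hj, pow_add, coe_generator_pow_card_sub_one, mul_one, hk]
  have hmem : (g : ZMod p) ^ (d * ((j - 1) / d)) ∈ unityRoots p t := by
    rw [mem_unityRoots, ← pow_mul, mul_right_comm, hdt, pow_mul,
      coe_generator_pow_card_sub_one, one_pow]
  rw [hb', period_mul ht hmem, period, sum_unityRoots_eq_sum_range hg hd ht hdt,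
    sum_Icc_one_of_periodic (fun x => (ZMod.stdAddChar ((g : ZMod p) ^ (d * x + y)) : ℂ)) t]
  · refine Finset.sum_congr rfl fun x _ => ?_
    rw [← pow_add, add_comm]
  · intro x
    rw [pow_add, generator_pow_periodic hdt, ← pow_add]

/-- This is cos x ≤ 1 - 2x^2/π^2 on [-π, π], at x = 2πv/p. -/
theorem re_stdAddChar_le (z : ZMod p) :
    (ZMod.stdAddChar z : ℂ).re ≤ 1 - 8 / (p : ℝ) ^ 2 * (z.valMinAbs : ℝ) ^ 2 := by
  have hp : (0 : ℝ) < p := by exact_mod_cast (Fact.out : p.Prime).pos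
  set v := z.valMinAbs with hv
  have hz : z = ((v : ℤ) : ZMod p) := (ZMod.coe_valMinAbs z).symm
  have habs : |(v : ℝ)| * 2 ≤ p := by
    have h1 := ZMod.natAbs_valMinAbs_le z
    have h2 : z.valMinAbs.natAbs * 2 ≤ p := by omega
    rw [← Int.cast_abs, Int.abs_eq_natAbs]
    exact_mod_cast h2
  have hre : (ZMod.stdAddChar z : ℂ).re = Real.cos (2 * Real.pi * v / p) := by
    rw [hz, ZMod.stdAddChar_coe, ← Complex.exp_ofReal_mul_I_re]
    congr 2
    push_cast
    ring
  rw [hre]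
  have hpi := Real.pi_pos
  have hx : |2 * Real.pi * v / p| ≤ Real.pi := by
    rw [abs_div, abs_mul, abs_mul, abs_two, abs_of_pos hpi, abs_of_pos hp, div_le_iff₀ hp]
    nlinarith
  refine (Real.cos_le_one_sub_mul_cos_sq hx).trans (le_of_eq ?_)
  field_simp
  ring

theorem re_period_le (hg : ∀ u : (ZMod p)ˣ, u ∈ Subgroup.zpowers g) {d t : ℕ}
    (hd : 1 ≤ d) (ht : 1 ≤ t) (hdt : d * t = p - 1) {M : ℝ}
    (hM : ∀ y : ℕ, 1 ≤ y → y ≤ d →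
      M ≤ ∑ x ∈ Icc 1 t, ((((g : ZMod p) ^ (d * x + y)).valMinAbs : ℤ) : ℝ) ^ 2)
    {b : ZMod p} (hb : b ≠ 0) :
    (period p t b).re ≤ t - 8 / (p : ℝ) ^ 2 * M := by
  obtain ⟨y, hy1, hyd, hy⟩ := exists_period_eq_sum_Icc hg hd ht hdt hb
  rw [hy, Complex.re_sum]
  calc _ ≤ ∑ x ∈ Icc 1 t, (1 - 8 / (p : ℝ) ^ 2 *
        ((((g : ZMod p) ^ (d * x + y)).valMinAbs : ℤ) : ℝ) ^ 2) :=
        Finset.sum_le_sum fun x _ => re_stdAddChar_le _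
    _ = t - 8 / (p : ℝ) ^ 2 *
        ∑ x ∈ Icc 1 t, ((((g : ZMod p) ^ (d * x + y)).valMinAbs : ℤ) : ℝ) ^ 2 := by
        rw [Finset.sum_sub_distrib, ← Finset.mul_sum]
        simp
    _ ≤ _ := by
        have := hM y hy1 hyd
        gcongr

/-- In the double sum over x - y substitute x = yk and sum over y for fixed k. -/
theorem norm_sq_period_eq_sum_re {t : ℕ} (ht : 1 ≤ t) (a : ZMod p) :
    ‖period p t a‖ ^ 2 = ∑ k ∈ unityRoots p t, (period p t (a * (k - 1))).re := by
  have h1 : ((‖period p t a‖ ^ 2 : ℝ) : ℂ) = ∑ k ∈ unityRoots p t, period p t (a * (k - 1)) := by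
    rw [norm_sq_period, Finset.sum_comm]
    calc _ = ∑ y ∈ unityRoots p t, ∑ k ∈ unityRoots p t,
          (ZMod.stdAddChar (a * (k - 1) * y) : ℂ) := by
          refine Finset.sum_congr rfl fun y hy => ?_
          rw [← sum_unityRoots_mul ht hy]
          exact Finset.sum_congr rfl fun k _ => by congr 1; ring
      _ = _ := by rw [Finset.sum_comm]; rfl
  have h2 := congrArg Complex.re h1
  rwa [Complex.ofReal_re, Complex.re_sum] at h2

/-- A lower bound for the sums of squares of the representatives gives an upper bound for
Gaussian periods. -/
theorem norm_period_le (hg : ∀ u : (ZMod p)ˣ, u ∈ Subgroup.zpowers g) {d t : ℕ}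
    (hd : 1 ≤ d) (ht : 1 ≤ t) (hdt : d * t = p - 1) {M : ℝ}
    (hM : ∀ y : ℕ, 1 ≤ y → y ≤ d →
      M ≤ ∑ x ∈ Icc 1 t, ((((g : ZMod p) ^ (d * x + y)).valMinAbs : ℤ) : ℝ) ^ 2)
    {a : ZMod p} (ha : a ≠ 0) :
    ‖period p t a‖ ≤ t - 4 * (1 - 1 / (t : ℝ)) * M / (p : ℝ) ^ 2 := by
  have hcard := card_unityRoots hg hd ht hdt
  have htpos : (0 : ℝ) < t := by exact_mod_cast ht
  have hp : (0 : ℝ) < p := by exact_mod_cast (Fact.out : p.Prime).pos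
  set δ : ℝ := 4 * (1 - 1 / (t : ℝ)) * M / (p : ℝ) ^ 2 with hδ
  have h1 : ‖period p t a‖ ^ 2 ≤ (t : ℝ) ^ 2 - 2 * t * δ := by
    have hone : (1 : ZMod p) ∈ unityRoots p t := by simp [mem_unityRoots]
    rw [norm_sq_period_eq_sum_re ht, ← Finset.add_sum_erase _ _ hone, sub_self, mul_zero,
      period_zero, hcard, Complex.natCast_re]
    have h2 : ∑ k ∈ (unityRoots p t).erase 1, (period p t (a * (k - 1))).re ≤
        ((t : ℝ) - 1) * (t - 8 / (p : ℝ) ^ 2 * M) := by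
      have h3 := Finset.sum_le_card_nsmul ((unityRoots p t).erase 1)
        (fun k => (period p t (a * (k - 1))).re) (t - 8 / (p : ℝ) ^ 2 * M) fun k hk =>
          re_period_le hg hd ht hdt hM
            (mul_ne_zero ha (sub_ne_zero.mpr (Finset.ne_of_mem_erase hk)))
      rwa [Finset.card_erase_of_mem hone, hcard, nsmul_eq_mul, Nat.cast_sub ht, Nat.cast_one] at h3
    have h4 : (t : ℝ) + (t - 1) * (t - 8 / (p : ℝ) ^ 2 * M) = (t : ℝ) ^ 2 - 2 * t * δ := by
      rw [hδ]; field_simp; ring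
    linarith
  -- This makes t - δ nonnegative, so that t^2 - 2tδ ≤ (t - δ)^2 permits taking square roots.
  have h2 : 2 * δ ≤ t := by
    have h3 : 0 ≤ (t : ℝ) ^ 2 - 2 * t * δ := (sq_nonneg _).trans h1
    nlinarith
  refine le_of_sq_le_sq ?_ (by linarith)
  nlinarith [sq_nonneg δ]

end Generator

end GaussPeriod

namespace GaussPeriod

open MeasureTheory

/-! ### Positivity of the Hermite constant. -/

section Hermite

theorem minNorm_le_sq {k : ℕ} (L : Submodule ℤ (EuclideanSpace ℝ (Fin k)))
    {v : EuclideanSpace ℝ (Fin k)} (hv : v ∈ L) (h0 : v ≠ 0) : Stechkin.minNorm L ≤ ‖v‖ ^ 2 := by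
  refine csInf_le ⟨0, ?_⟩ ⟨v, hv, h0, rfl⟩
  rintro s ⟨w, _, _, rfl⟩
  positivity

/-- Minkowski's theorem bounds the minimal norm of a lattice by its covolume. -/
theorem minNorm_le_mul_covolume {k : ℕ} (hk : 1 ≤ k)
    (L : Submodule ℤ (EuclideanSpace ℝ (Fin k))) [DiscreteTopology L] [IsZLattice ℝ L] :
    Stechkin.minNorm L ≤
      (2 ^ (k + 1) / volume.real (Metric.ball (0 : EuclideanSpace ℝ (Fin k)) 1)) ^ (2 / (k : ℝ)) *
        ZLattice.covolume L ^ (2 / (k : ℝ)) := by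
  have : Nonempty (Fin k) := ⟨⟨0, hk⟩⟩
  set E := EuclideanSpace ℝ (Fin k)
  set V : ℝ := volume.real (Metric.ball (0 : E) 1) with hV
  have hVpos : 0 < V := ENNReal.toReal_pos
    (Metric.measure_ball_pos volume (0 : E) one_pos).ne' measure_ball_lt_top.ne
  have hcpos : 0 < ZLattice.covolume L := ZLattice.covolume_pos L
  set c := ZLattice.covolume L with hc
  -- The ball of radius R has volume 2 · 2^k · covol; the extra factor 2 makes Minkowski's
  -- inequality strict.
  set R : ℝ := (2 ^ (k + 1) / V * c) ^ (1 / (k : ℝ)) with hR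
  have hbase : 0 < 2 ^ (k + 1) / V * c := by positivity
  have hRpos : 0 < R := Real.rpow_pos_of_pos hbase _
  have hk0 : (k : ℝ) ≠ 0 := by positivity
  have hRk : R ^ k = 2 ^ (k + 1) / V * c := by
    rw [hR, ← Real.rpow_natCast, ← Real.rpow_mul hbase.le, one_div_mul_cancel hk0, Real.rpow_one]
  let b := Module.Free.chooseBasis ℤ L
  have hfund := ZLattice.isAddFundamentalDomain b (volume : Measure E)
  have hcov := ZLattice.covolume_eq_measure_fundamentalDomain L volume hfund
  set D := ZSpan.fundamentalDomain (b.ofZLatticeBasis ℝ) with hD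
  have hDfin : volume D ≠ ⊤ := by
    intro h
    rw [measureReal_def, h, ENNReal.toReal_top] at hcov
    exact hcpos.ne' hcov
  have hvol : volume D * 2 ^ Module.finrank ℝ E < volume (Metric.ball (0 : E) R) := by
    rw [Measure.addHaar_ball volume (0 : E) hRpos.le]
    have hfr : Module.finrank ℝ E = k := by simp [E]
    rw [hfr, hRk, ← ENNReal.ofReal_toReal hDfin,
      ← ENNReal.ofReal_toReal (measure_ball_lt_top (μ := volume) (x := (0 : E)) (r := 1)).ne,
      ← ENNReal.ofReal_mul hbase.le, show (2 : ENNReal) ^ k = ENNReal.ofReal (2 ^ k) by simp,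
      ← ENNReal.ofReal_mul ENNReal.toReal_nonneg]
    refine (ENNReal.ofReal_lt_ofReal_iff (by positivity)).mpr ?_
    rw [← measureReal_def, ← measureReal_def, ← hcov, ← hc, ← hV]
    have h1 : 2 ^ (k + 1) / V * c * V = 2 * (c * 2 ^ k) := by field_simp; ring
    rw [h1]
    have : 0 < c * 2 ^ k := by positivity
    linarith
  have : Countable L.toAddSubgroup := inferInstanceAs (Countable L)
  obtain ⟨v, hv0, hv⟩ := exists_ne_zero_mem_lattice_of_measure_mul_two_pow_lt_measure
    (L := L.toAddSubgroup) hfund (s := Metric.ball (0 : E) R)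
    (fun x hx => by simpa using hx) (convex_ball _ _) hvol
  have hvR : ‖(v : E)‖ ≤ R := by simpa using (mem_ball_zero_iff.mp hv).le
  calc Stechkin.minNorm L ≤ ‖(v : E)‖ ^ 2 := minNorm_le_sq L v.2 (by simpa using hv0)
    _ ≤ R ^ 2 := by gcongr
    _ = (2 ^ (k + 1) / V * c) ^ (2 / (k : ℝ)) := by
      rw [hR, ← Real.rpow_natCast, ← Real.rpow_mul hbase.le]
      congr 1
      push_cast; ring
    _ = _ := Real.mul_rpow (by positivity) hcpos.le

theorem one_le_minNorm_integer_lattice {k : ℕ} (hk : 1 ≤ k) :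
    1 ≤ Stechkin.minNorm (Submodule.span ℤ
      (Set.range (EuclideanSpace.basisFun (Fin k) ℝ).toBasis)) := by
  set b := (EuclideanSpace.basisFun (Fin k) ℝ).toBasis with hb
  refine le_csInf ?_ ?_
  · exact ⟨_, b ⟨0, hk⟩, Submodule.subset_span ⟨_, rfl⟩, b.ne_zero _, rfl⟩
  · rintro s ⟨v, hv, hv0, rfl⟩
    rw [b.mem_span_iff_repr_mem ℤ] at hv
    obtain ⟨i, hi⟩ : ∃ i, v i ≠ 0 := by
      by_contra! h
      exact hv0 (by ext i; simpa using h i)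
    obtain ⟨n, hn⟩ := hv i
    have hn' : v i = n := by simpa [hb] using hn.symm
    have hn0 : n ≠ 0 := by
      rintro rfl
      exact hi (by simpa using hn')
    have h1 : (1 : ℝ) ≤ (v i) ^ 2 := by
      rw [hn']
      have h : (0 : ℤ) < n ^ 2 := by positivity
      have h' : (1 : ℤ) ≤ n ^ 2 := h
      have h'' : ((1 : ℤ) : ℝ) ≤ ((n ^ 2 : ℤ) : ℝ) := Int.cast_le.mpr h'
      rwa [Int.cast_one, Int.cast_pow] at h''
    rw [EuclideanSpace.norm_sq_eq]
    refine h1.trans ?_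
    have := Finset.single_le_sum (f := fun j => ‖v j‖ ^ 2) (fun _ _ => by positivity)
      (Finset.mem_univ i)
    simpa using this

/-- The integer lattice gives a positive member of the set. Boundedness (Minkowski) is also needed,
since the real `sSup` of an unbounded set is 0. -/
theorem hermiteConstant_pos {k : ℕ} (hk : 1 ≤ k) : 0 < Stechkin.hermiteConstant k := by
  set b := (EuclideanSpace.basisFun (Fin k) ℝ).toBasis with hb
  have hpos : 0 < Stechkin.minNorm (Submodule.span ℤ (Set.range b)) /
      ZLattice.covolume (Submodule.span ℤ (Set.range b)) ^ (2 / (k : ℝ)) :=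
    div_pos (one_pos.trans_le (one_le_minNorm_integer_lattice hk))
      (Real.rpow_pos_of_pos (ZLattice.covolume_pos (Submodule.span ℤ (Set.range b))) _)
  refine hpos.trans_le (le_csSup ?_ ⟨_, inferInstance, inferInstance, rfl⟩)
  refine ⟨(2 ^ (k + 1) / volume.real (Metric.ball (0 : EuclideanSpace ℝ (Fin k)) 1)) ^
    (2 / (k : ℝ)), ?_⟩
  rintro s ⟨L, hL, hL', rfl⟩
  have hc : 0 < ZLattice.covolume L := ZLattice.covolume_pos L
  exact (div_le_iff₀ (Real.rpow_pos_of_pos hc _)).mpr (minNorm_le_mul_covolume hk L)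

end Hermite

end GaussPeriod

namespace GaussPeriod

/-! ### The constants C_r, K_r and λ. -/

section Constants

theorem C_pos {r : ℕ} (hr : 2 ≤ r) : 0 < Stechkin.C r := by
  have hγ := hermiteConstant_pos (k := r - 1) (by omega)
  have hr0 : (0 : ℝ) < r := by positivity
  exact Real.rpow_pos_of_pos (by positivity) _

theorem F_div_sq_eq {r t p : ℕ} (hr : 2 ≤ r) (hp : 0 < p) :
    Stechkin.F r t p / (p : ℝ) ^ 2 =
      Stechkin.C r * (t : ℝ) ^ (1 / (r : ℝ)) / (p : ℝ) ^ (2 / (r : ℝ)) := by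
  have hγ := hermiteConstant_pos (k := r - 1) (by omega)
  have hr0 : (0 : ℝ) < r := by positivity
  have hp0 : (0 : ℝ) < p := by exact_mod_cast hp
  have h1 : ((p : ℝ) ^ (2 * (r - 1))) ^ (1 / (r : ℝ)) =
      (p : ℝ) ^ 2 / (p : ℝ) ^ (2 / (r : ℝ)) := by
    rw [← Real.rpow_natCast, ← Real.rpow_mul hp0.le, ← Real.rpow_natCast, ← Real.rpow_sub hp0]
    congr 1
    rw [Nat.cast_mul, Nat.cast_sub (by omega)]
    push_cast
    field_simp
  rw [Stechkin.F, Stechkin.C, Real.div_rpow (by positivity) (by positivity),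
    Real.mul_rpow (by positivity) (by positivity), h1, Real.rpow_neg (by positivity)]
  have : 0 < (p : ℝ) ^ (2 / (r : ℝ)) := Real.rpow_pos_of_pos hp0 _
  field_simp

theorem two_le_f {r t : ℕ} (hr : 2 ≤ r) (hrt : r ≤ Nat.totient t) : 2 ≤ Stechkin.f r := by
  have hmem : r ≤ Nat.totient (Stechkin.f r) :=
    Nat.sInf_mem (s := {m : ℕ | r ≤ Nat.totient m}) ⟨t, hrt⟩
  by_contra! h
  have : Stechkin.f r = 0 ∨ Stechkin.f r = 1 := by omega
  rcases this with h | h <;> simp [h] at hmem <;> omega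

theorem K_pos {r t : ℕ} (hr : 2 ≤ r) (hrt : r ≤ Nat.totient t) : 0 < Stechkin.K r := by
  have h2 : (2 : ℝ) ≤ Stechkin.f r := by exact_mod_cast two_le_f hr hrt
  have h3 : 1 / (Stechkin.f r : ℝ) ≤ 1 / 2 := by gcongr
  exact mul_pos (by linarith) (C_pos hr)

/-- Minimality of f_r gives f_r ≤ t, which removes t from the factor 1 - 1/t. -/
theorem K_le {r t : ℕ} (hr : 2 ≤ r) (hrt : r ≤ Nat.totient t) :
    Stechkin.K r ≤ 4 * (1 - 1 / (t : ℝ)) * Stechkin.C r := by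
  have h1 : Stechkin.f r ≤ t := Nat.sInf_le hrt
  have h2 : (2 : ℝ) ≤ Stechkin.f r := by exact_mod_cast two_le_f hr hrt
  have h3 : 1 / (t : ℝ) ≤ 1 / (Stechkin.f r : ℝ) := by gcongr
  have := C_pos hr
  rw [Stechkin.K]
  gcongr

theorem lam_pos : 0 < Stechkin.lam := by
  unfold Stechkin.lam; positivity

theorem lam_pow_eight : Stechkin.lam ^ 8 = 256 / 9 := by
  rw [Stechkin.lam, mul_pow, ← Real.rpow_natCast ((3 : ℝ) ^ _), ← Real.rpow_mul (by norm_num)]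
  rw [show (-(1 / 4) : ℝ) * ((8 : ℕ) : ℝ) = ((-2 : ℤ) : ℝ) by norm_num, Real.rpow_intCast]
  norm_num

end Constants

/-! ### The two ranges of d, and the conclusion. -/

section MainCases

variable {p : ℕ} [Fact p.Prime] {g : (ZMod p)ˣ}

/-- The case where the lower bound for the sums of squares is decisive. -/
theorem norm_S_le_of_index_large (hg : ∀ u : (ZMod p)ˣ, u ∈ Subgroup.zpowers g)
    {n d t r : ℕ} {Θ : ℝ} (hΘ : 0 ≤ Θ) (hd : 1 ≤ d) (hdn : d ≤ n) (ht : 1 ≤ t)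
    (hdt : d * t = p - 1) (hr : 2 ≤ r) (hrt : r ≤ Nat.totient t)
    (hbracket : ∀ y : ℕ, 1 ≤ y → y ≤ d →
      Θ * Stechkin.F r t p ≤
        ∑ x ∈ Finset.Icc 1 t, ((((g : ZMod p) ^ (d * x + y)).valMinAbs : ℤ) : ℝ) ^ 2)
    (hlarge : (p : ℝ) * (p : ℝ) ^ (2 / (r : ℝ)) * Real.log p * (d : ℝ) ^ (1 / (r : ℝ)) ≤
      (d : ℝ) ^ 2 * (Θ * Stechkin.K r * ((p : ℝ) - 1) ^ (1 / (r : ℝ))))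
    {a : ℤ} (ha : (a : ZMod p) ≠ 0) :
    ‖Stechkin.S d a p‖ ≤ (p : ℝ) ^ (1 - 1 / (n : ℝ)) := by
  have hpp := (Fact.out : p.Prime)
  have hp0 : (0 : ℝ) < p := by exact_mod_cast hpp.pos
  have hp1 : (1 : ℝ) ≤ p := by exact_mod_cast hpp.one_le
  have hd0 : (0 : ℝ) < d := by exact_mod_cast hd
  have ht0 : (0 : ℝ) < t := by exact_mod_cast ht
  have hdn' : (d : ℝ) ≤ n := by exact_mod_cast hdn
  have hdtR : (d : ℝ) * t = p - 1 := by
    rw [← Nat.cast_mul, hdt, Nat.cast_sub hpp.one_le, Nat.cast_one]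
  set q : ℝ := (p : ℝ) ^ (2 / (r : ℝ)) with hq
  set u : ℝ := (d : ℝ) ^ (1 / (r : ℝ)) with hu
  set v : ℝ := (t : ℝ) ^ (1 / (r : ℝ)) with hv
  have hq0 : 0 < q := Real.rpow_pos_of_pos hp0 _
  have hu0 : 0 < u := Real.rpow_pos_of_pos hd0 _
  have hv0 : 0 < v := Real.rpow_pos_of_pos ht0 _
  have huv : ((p : ℝ) - 1) ^ (1 / (r : ℝ)) = u * v := by
    rw [← hdtR, Real.mul_rpow hd0.le ht0.le]
  rw [huv] at hlarge
  have hT := norm_period_le hg hd ht hdt hbracket ha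
  have hT' : ‖period p t (a : ZMod p)‖ ≤ t - Θ * Stechkin.K r * v / q := by
    refine hT.trans (sub_le_sub_left ?_ _)
    calc Θ * Stechkin.K r * v / q
        ≤ Θ * (4 * (1 - 1 / (t : ℝ)) * Stechkin.C r) * v / q := by
          have := K_le hr hrt
          gcongr
      _ = 4 * (1 - 1 / (t : ℝ)) * Θ * (Stechkin.C r * v / q) := by ring
      _ = 4 * (1 - 1 / (t : ℝ)) * Θ * (Stechkin.F r t p / (p : ℝ) ^ 2) := by
          rw [F_div_sq_eq hr hpp.pos]
      _ = _ := by ring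
  -- The size condition gives a saving of p log p / d, and d ≤ n.
  have hgain : (p : ℝ) * Real.log p / n ≤ d * (Θ * Stechkin.K r * v / q) := by
    have hlog : 0 ≤ Real.log p := Real.log_nonneg hp1
    calc (p : ℝ) * Real.log p / n ≤ p * Real.log p / d := by gcongr
      _ ≤ _ := by
        rw [div_le_iff₀ hd0]
        have h1 : (p : ℝ) * Real.log p * q ≤ (d : ℝ) ^ 2 * (Θ * Stechkin.K r * v) := by
          refine le_of_mul_le_mul_right ?_ hu0
          linarith
        have h2 : (d : ℝ) * (Θ * Stechkin.K r * v / q) * d =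
            (d : ℝ) ^ 2 * (Θ * Stechkin.K r * v) / q := by ring
        rw [h2, le_div_iff₀ hq0]
        exact h1
  have hexp : (p : ℝ) - p * Real.log p / n ≤ (p : ℝ) ^ (1 - 1 / (n : ℝ)) := by
    rw [sub_eq_add_neg (1 : ℝ), Real.rpow_add hp0, Real.rpow_one, Real.rpow_def_of_pos hp0]
    have h1 := Real.add_one_le_exp (Real.log p * -(1 / (n : ℝ)))
    calc (p : ℝ) - p * Real.log p / n = p * (Real.log p * -(1 / (n : ℝ)) + 1) := by ring
      _ ≤ _ := by gcongr
  rw [S_eq hg hd ht hdt]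
  calc ‖1 + (d : ℂ) * period p t (a : ZMod p)‖
      ≤ 1 + d * ‖period p t (a : ZMod p)‖ := by
        refine (norm_add_le _ _).trans (le_of_eq ?_)
        rw [norm_one, norm_mul, Complex.norm_natCast]
    _ ≤ 1 + d * (t - Θ * Stechkin.K r * v / q) := by gcongr
    _ = p - d * (Θ * Stechkin.K r * v / q) := by rw [mul_sub, hdtR]; ring
    _ ≤ p - p * Real.log p / n := sub_le_sub_left hgain _
    _ ≤ _ := hexp

/-- The case where the additive energy bound is decisive. -/
theorem norm_S_le_of_index_small (hg : ∀ u : (ZMod p)ˣ, u ∈ Subgroup.zpowers g)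
    {n d t r : ℕ} {Y : ℝ} (hY : 0 < Y) (hd : 1 ≤ d) (ht : 1 ≤ t)
    (hdt : d * t = p - 1) (hr : 2 ≤ r)
    (hpbound : 1 + Stechkin.lam * ((p : ℝ) ^ 5 * Real.log p / Y) ^
      (3 * (r : ℝ) / (16 * (r : ℝ) - 8)) ≤ (p : ℝ) ^ (1 - 1 / (n : ℝ)))
    (hsmall : (d : ℝ) ^ 2 * Y ≤
      (p : ℝ) * (p : ℝ) ^ (2 / (r : ℝ)) * Real.log p * (d : ℝ) ^ (1 / (r : ℝ)))
    {a : ℤ} (ha : (a : ZMod p) ≠ 0) :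
    ‖Stechkin.S d a p‖ ≤ (p : ℝ) ^ (1 - 1 / (n : ℝ)) := by
  have hpp := (Fact.out : p.Prime)
  have hp0 : (0 : ℝ) < p := by exact_mod_cast hpp.pos
  have hp1 : (1 : ℝ) ≤ p := by exact_mod_cast hpp.one_le
  have hd0 : (0 : ℝ) < d := by exact_mod_cast hd
  have hr2 : (2 : ℝ) ≤ r := by exact_mod_cast hr
  have hr0 : (0 : ℝ) < r := by linarith
  have hlam := lam_pos
  -- The period bound reads d|T| ≤ λ w^(3/8). The condition on d bounds w^((2r-1)/r), and 3/8 =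
  -- ((2r-1)/r) · 3r/(16r-8).
  set w : ℝ := (p : ℝ) ^ 2 * d with hw
  have hw0 : 0 < w := by positivity
  set W : ℝ := w ^ ((3 : ℝ) / 8) with hWdef
  have hW0 : 0 ≤ W := (Real.rpow_pos_of_pos hw0 _).le
  have hW8 : W ^ 8 = w ^ 3 := by
    rw [hWdef, ← Real.rpow_natCast, ← Real.rpow_mul hw0.le,
      show (3 : ℝ) / 8 * ((8 : ℕ) : ℝ) = ((3 : ℕ) : ℝ) by norm_num, Real.rpow_natCast]
  have hWle : W ≤ ((p : ℝ) ^ 5 * Real.log p / Y) ^ (3 * (r : ℝ) / (16 * (r : ℝ) - 8)) := by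
    have h1 : w ^ ((2 * (r : ℝ) - 1) / r) ≤ (p : ℝ) ^ 5 * Real.log p / Y := by
      have h2 : w ^ ((2 * (r : ℝ) - 1) / r) = (p : ℝ) ^ 4 * (d : ℝ) ^ 2 /
          ((p : ℝ) ^ (2 / (r : ℝ)) * (d : ℝ) ^ (1 / (r : ℝ))) := by
        rw [show (2 * (r : ℝ) - 1) / r = ((2 : ℕ) : ℝ) - 1 / r by push_cast; field_simp,
          Real.rpow_sub hw0, Real.rpow_natCast, hw,
          Real.mul_rpow (by positivity) hd0.le]
        congr 1
        · ring
        · congr 1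
          rw [← Real.rpow_natCast, ← Real.rpow_mul hp0.le]
          congr 1
          push_cast; ring
      have hq0 : 0 < (p : ℝ) ^ (2 / (r : ℝ)) := Real.rpow_pos_of_pos hp0 _
      have hu0 : 0 < (d : ℝ) ^ (1 / (r : ℝ)) := Real.rpow_pos_of_pos hd0 _
      rw [h2, div_le_div_iff₀ (by positivity) hY]
      calc (p : ℝ) ^ 4 * (d : ℝ) ^ 2 * Y = (p : ℝ) ^ 4 * ((d : ℝ) ^ 2 * Y) := by ring
        _ ≤ (p : ℝ) ^ 4 * ((p : ℝ) * (p : ℝ) ^ (2 / (r : ℝ)) * Real.log p *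
            (d : ℝ) ^ (1 / (r : ℝ))) := by gcongr
        _ = _ := by ring
    have h3 : W = (w ^ ((2 * (r : ℝ) - 1) / r)) ^ (3 * (r : ℝ) / (16 * (r : ℝ) - 8)) := by
      rw [hWdef, ← Real.rpow_mul hw0.le]
      congr 1
      have : 2 * (r : ℝ) - 1 ≠ 0 := by linarith
      rw [show 16 * (r : ℝ) - 8 = 8 * (2 * r - 1) by ring]
      field_simp
    rw [h3]
    refine Real.rpow_le_rpow (Real.rpow_nonneg hw0.le _) h1 (div_nonneg (by linarith) (by linarith))
  have hbound : 1 + Stechkin.lam * W ≤ (p : ℝ) ^ (1 - 1 / (n : ℝ)) :=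
    le_trans (by gcongr) hpbound
  have hQp : (p : ℝ) ^ (1 - 1 / (n : ℝ)) ≤ p := by
    calc (p : ℝ) ^ (1 - 1 / (n : ℝ)) ≤ (p : ℝ) ^ (1 : ℝ) :=
          Real.rpow_le_rpow_of_exponent_le hp1 (sub_le_self _ (by positivity))
      _ = p := Real.rpow_one _
  -- The hypothesis on p already forces λW < p, which is exactly this side condition.
  have hdp : 256 * d ^ 3 < 9 * p ^ 2 := by
    have h1 : Stechkin.lam * W < p := by linarith
    have h2 : (Stechkin.lam * W) ^ 8 < (p : ℝ) ^ 8 :=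
      pow_lt_pow_left₀ h1 (by positivity) (by norm_num)
    rw [mul_pow, lam_pow_eight, hW8, hw] at h2
    have h3 : (256 * (d : ℝ) ^ 3) * (p : ℝ) ^ 6 < (9 * (p : ℝ) ^ 2) * (p : ℝ) ^ 6 := by
      linarith [show 256 / 9 * ((p : ℝ) ^ 2 * d) ^ 3 = 256 * (d : ℝ) ^ 3 * (p : ℝ) ^ 6 / 9 by ring]
    have h4 := lt_of_mul_lt_mul_right h3 (by positivity)
    exact_mod_cast h4
  have hcard := card_unityRoots hg hd ht hdt
  have hT := norm_period_pow_eight_le_of_index hdt hdp hcard ha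
  have hdT : d * ‖period p t (a : ZMod p)‖ ≤ Stechkin.lam * W := by
    refine le_of_pow_le_pow_left₀ (n := 8) (by norm_num) (by positivity) ?_
    rw [mul_pow, mul_pow, lam_pow_eight, hW8, hw]
    have h1 : (d : ℝ) ^ 3 * (9 * (d : ℝ) ^ 5 * ‖period p t (a : ZMod p)‖ ^ 8) ≤
      (d : ℝ) ^ 3 * (256 * (p : ℝ) ^ 6) := by gcongr
    linarith [show 256 / 9 * ((p : ℝ) ^ 2 * d) ^ 3 = (d : ℝ) ^ 3 * (256 * (p : ℝ) ^ 6) / 9 by ring,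
      show (d : ℝ) ^ 8 * ‖period p t (a : ZMod p)‖ ^ 8 =
        (d : ℝ) ^ 3 * (9 * (d : ℝ) ^ 5 * ‖period p t (a : ZMod p)‖ ^ 8) / 9 by ring]
  rw [S_eq hg hd ht hdt]
  calc ‖1 + (d : ℂ) * period p t (a : ZMod p)‖
      ≤ 1 + d * ‖period p t (a : ZMod p)‖ := by
        refine (norm_add_le _ _).trans (le_of_eq ?_)
        rw [norm_one, norm_mul, Complex.norm_natCast]
    _ ≤ 1 + Stechkin.lam * W := by gcongr
    _ ≤ _ := hbound

end MainCases

end GaussPeriod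

theorem proposition1 (n p : ℕ) (hn : 1 ≤ n) (hp : p.Prime)
    (g : (ZMod p)ˣ) (hg : ∀ u : (ZMod p)ˣ, u ∈ Subgroup.zpowers g)
    (Θ : ℝ) (hΘ : 1 ≤ Θ)
    (d t : ℕ) (hd : d = Nat.gcd n (p - 1)) (ht : t = (p - 1) / d)
    (r : ℕ) (hr : 2 ≤ r) (hrt : r ≤ Nat.totient t)
    (hbracket : ∀ y : ℕ, 1 ≤ y → y ≤ d →
      Θ * Stechkin.F r t p ≤
        ∑ x ∈ Finset.Icc 1 t, ((((g : ZMod p) ^ (d * x + y)).valMinAbs : ℤ) : ℝ) ^ 2)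
    (hpbound :
      1 + Stechkin.lam *
          ((p : ℝ) ^ 5 * Real.log (p : ℝ) /
            (Θ * Stechkin.K r * ((p : ℝ) - 1) ^ (1 / (r : ℝ)))) ^
            (3 * (r : ℝ) / (16 * (r : ℝ) - 8))
        ≤ (p : ℝ) ^ (1 - 1 / (n : ℝ))) :
    Stechkin.G d p ≤ (p : ℝ) ^ (1 - 1 / (n : ℝ)) := by
  have : Fact p.Prime := ⟨hp⟩
  have hp1 : 1 ≤ p - 1 := by have := hp.two_le; omega
  have hd1 : 1 ≤ d := by rw [hd]; exact Nat.gcd_pos_of_pos_left _ hn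
  have hdn : d ≤ n := by rw [hd]; exact Nat.gcd_le_left _ hn
  have hdvd : d ∣ p - 1 := by rw [hd]; exact Nat.gcd_dvd_right _ _
  have hdt : d * t = p - 1 := by rw [ht]; exact Nat.mul_div_cancel' hdvd
  have ht1 : 1 ≤ t := by
    rcases Nat.eq_zero_or_pos t with h | h
    · rw [h] at hdt; omega
    · exact h
  have hK := GaussPeriod.K_pos hr hrt
  have hp0 : (0 : ℝ) < (p : ℝ) - 1 := by
    have : (2 : ℝ) ≤ p := by exact_mod_cast hp.two_le
    linarith
  have hY : 0 < Θ * Stechkin.K r * ((p : ℝ) - 1) ^ (1 / (r : ℝ)) := by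
    have := Real.rpow_pos_of_pos hp0 (1 / (r : ℝ))
    have : 0 < Θ := by linarith
    positivity
  refine Real.sSup_le ?_ (by positivity)
  rintro s ⟨a, ha, rfl⟩
  have ha0 : (a : ZMod p) ≠ 0 := by
    rw [Ne, ZMod.intCast_zmod_eq_zero_iff_dvd]
    intro h
    have hgcd := (Int.gcd_eq_right_iff_dvd (Int.natCast_nonneg p)).mpr h
    rw [ha] at hgcd
    exact hp.one_lt.ne (by exact_mod_cast hgcd)
  -- The threshold for d at which the saving from the sums of squares just reaches p log p / d.
  rcases le_total ((p : ℝ) * (p : ℝ) ^ (2 / (r : ℝ)) * Real.log p * (d : ℝ) ^ (1 / (r : ℝ)))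
      ((d : ℝ) ^ 2 * (Θ * Stechkin.K r * ((p : ℝ) - 1) ^ (1 / (r : ℝ)))) with h | h
  · exact GaussPeriod.norm_S_le_of_index_large hg (by linarith) hd1 hdn ht1 hdt hr hrt hbracket h ha0
  · exact GaussPeriod.norm_S_le_of_index_small hg hY hd1 ht1 hdt hr hpbound h ha0
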